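/- Let $\mathbb S=\{y_0<y_1<\dots<y_N\}\subset\mathbb R$ be a finite set and let $Y$ be a right-continuous continuous-time Markov chain on $\mathbb S$ with transition rate matrix $\bm G=(G(x,y))_{x,y\in\mathbb S}$, where $G(x,y)\ge 0$ for $y\ne x$ and $G(x,x)=-\sum_{y\neq x}G(x,y)$, and where $y_0$ and $y_N$ are absorbing; under $\mathbb P_x$ (with expectation $\mathbb E_x$) the chain starts at $Y_0=x$ and has transition matrices $e^{t\bm G}$, $t\ge 0$. Let $a>0$. Put $\tilde\tau_{a,0}=0$ and, for $n\ge 1$, \[\tilde\tau_{a,n}=\inf\Big\{t>\tilde\tau_{a,n-1}:\ \sup_{\tilde\tau_{a,n-1}\le u\le t}Y_u-Y_t\ge a\Big\}\in[0,\infty],\qquad \inf\emptyset=\infty ,\] the $n$-th drawdown time without recovery. For $A\subseteq\mathbb R$ let $T_A=\inf\{t>0:\ Y_t\notin A\}$, and for $q\in\mathbb C$ and $f:\mathbb S\to\mathbb C$ let \[P_A(q,x;f)=\mathbb E_x\big[e^{-qT_A}\mathbf 1_{\{T_A<\infty\}}f(Y_{T_A})\big].\] Let $q\in\mathbb C$ with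 $\Re(q)>0$. For every $x\in\mathbb S$ the expectations below are those of integrable random variables, the series \[H(q,x):=\sum_{k=1}^\infty \mathbb E_x\big[e^{-q\tilde\tau_{a,k}}\big]\qquad(\text{with } e^{-q\cdot\infty}:=0)\] converges absolutely, and $H(q,\cdot)$ satisfies the linear system \[H(q,x)=\sum_{y\in\mathbb S,\,y\le x-a}P_{(x-a,x]}(q,x;\mathbf 1_{\{\cdot=y\}})\,(1+H(q,y))+\sum_{y\in\mathbb S,\,y>x}P_{(x-a,x]}(q,x;\mathbf 1_{\{\cdot=y\}})\,H(q,y),\qquad x\in\mathbb S .\] Moreover, for every real $r_f$ with $\Re(q)+r_f>0$ (in particular every $r_f\ge 0$), the price $V(T)=\sum_{k=1}^{\infty}\mathbb E_x\big[e^{-r_f\tilde\tau_{a,k}}\mathbf 1_{\{\tilde\tau_{a,k}<T\}}\big]$ of the drawdown insurance without recovery with maturity $T$ is finite for every $T>0$, the function $T\mapsto e^{-qT}V(T)$ is integrable on $(0,\infty)$, and \[\int_0^\infty e^{-qT}\,V(T)\,dT=\frac{H(q+r_f,x)}{q}.\] -/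

import Mathlib

open MeasureTheory
open scoped NNReal ENNReal

noncomputable section

/-- `G` is a transition rate matrix on the finite grid `S ⊆ ℝ`: nonnegative off the diagonal,
and every diagonal entry is minus the sum of the other entries of its row. -/
structure IsRateMatrix {S : Finset ℝ} (G : Matrix S S ℝ) : Prop where
  offDiag_nonneg : ∀ x y : S, y ≠ x → 0 ≤ G x y
  diag_eq : ∀ x : S, G x x = -∑ y ∈ Finset.univ.erase x, G x y

/-- The state `x` is absorbing: all rates out of it vanish. -/
def IsAbsorbingState {S : Finset ℝ} (G : Matrix S S ℝ) (x : S) : Prop :=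
  ∀ y : S, G x y = 0

/-- `Y`, under the family of laws `ℙ x` (`x ∈ S`), is a continuous-time Markov chain on `S` with
transition rate matrix `G`: it has right-continuous paths, starts at `x` under `ℙ x`, and its
finite-dimensional distributions are those of the Markov chain with transition matrices
`p(t) = exp (t G)`, that is, for `0 = t₀ ≤ t₁ ≤ … ≤ tₙ` and `y₀ = x`,
`ℙ x (Y_{t₁} = y₁, …, Y_{tₙ} = yₙ) = ∏_{i < n} p(tᵢ₊₁ - tᵢ)(yᵢ, yᵢ₊₁)`. -/
structure IsCTMC {Ω : Type*} [MeasurableSpace Ω] {S : Finset ℝ} (G : Matrix S S ℝ)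
    (ℙ : S → Measure Ω) (Y : ℝ≥0 → Ω → S) : Prop where
  isProbabilityMeasure : ∀ x : S, IsProbabilityMeasure (ℙ x)
  measurable : ∀ t : ℝ≥0, Measurable (Y t)
  rightContinuous : ∀ (ω : Ω) (t : ℝ≥0), ContinuousWithinAt (fun s => Y s ω) (Set.Ici t) t
  start : ∀ x : S, ∀ᵐ ω ∂(ℙ x), Y 0 ω = x
  finDimDistr : ∀ (x : S) (n : ℕ) (t : ℕ → ℝ≥0) (y : ℕ → S),
    Monotone t → t 0 = 0 → y 0 = x →
      (ℙ x).real {ω | ∀ i < n, Y (t (i + 1)) ω = y (i + 1)} =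
        ∏ i ∈ Finset.range n,
          NormedSpace.exp (((t (i + 1) : ℝ) - (t i : ℝ)) • G) (y i) (y (i + 1))

/-- First passage time `T_A = inf {t > 0 : Y_t ∉ A}`, with `inf ∅ = ∞`. -/
def firstPassageTime {Ω : Type*} {S : Finset ℝ} (Y : ℝ≥0 → Ω → S) (A : Set ℝ) (ω : Ω) : ℝ≥0∞ :=
  ⨅ (t : ℝ≥0) (_ : 0 < t ∧ (Y t ω : ℝ) ∉ A), (t : ℝ≥0∞)

/-- The random variable `exp (-∫₀^{T_A} k(Y_s) ds) 1_{T_A < ∞} f(Y_{T_A})`. -/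
def firstPassagePayoff {Ω : Type*} {S : Finset ℝ} (Y : ℝ≥0 → Ω → S) (A : Set ℝ)
    (k f : S → ℂ) (ω : Ω) : ℂ :=
  if firstPassageTime Y A ω < ∞ then
    Complex.exp (-∫ s in (0 : ℝ)..(firstPassageTime Y A ω).toReal, k (Y s.toNNReal ω)) *
      f (Y (firstPassageTime Y A ω).toNNReal ω)
  else 0

/-- `P_A(k, x; f) = 𝔼_x[exp (-∫₀^{T_A} k(Y_s) ds) 1_{T_A < ∞} f(Y_{T_A})]`. -/
def firstPassageValue {Ω : Type*} [MeasurableSpace Ω] {S : Finset ℝ} (ℙ : S → Measure Ω)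
    (Y : ℝ≥0 → Ω → S) (A : Set ℝ) (k : S → ℂ) (x : S) (f : S → ℂ) : ℂ :=
  ∫ ω, firstPassagePayoff Y A k f ω ∂(ℙ x)

/-- The running supremum `sup_{s ≤ u ≤ t} Y_u`, where `s` may be given in `[0, ∞]`. -/
def runningSup {Ω : Type*} {S : Finset ℝ} (Y : ℝ≥0 → Ω → S) (s : ℝ≥0∞) (t : ℝ≥0) (ω : Ω) : ℝ :=
  sSup ((fun u : ℝ≥0 => (Y u ω : ℝ)) '' {u : ℝ≥0 | s ≤ u ∧ u ≤ t})

/-- The `n`-th drawdown time without recovery: `τ₀ = 0` and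
`τₙ₊₁ = inf {t > τₙ : sup_{τₙ ≤ u ≤ t} Y_u - Y_t ≥ a}`, with `inf ∅ = ∞`. -/
def drawdownTime {Ω : Type*} {S : Finset ℝ} (Y : ℝ≥0 → Ω → S) (a : ℝ) : ℕ → Ω → ℝ≥0∞
  | 0, _ => 0
  | n + 1, ω =>
    ⨅ (t : ℝ≥0) (_ : drawdownTime Y a n ω < t ∧
      a ≤ runningSup Y (drawdownTime Y a n ω) t ω - (Y t ω : ℝ)), (t : ℝ≥0∞)

/-- The discount factor `e^{-q τ}` for a time `τ ∈ [0, ∞]`, with `e^{-q ∞} = 0`. -/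
def discount (q : ℂ) (τ : ℝ≥0∞) : ℂ :=
  if τ < ∞ then Complex.exp (-q * (τ.toReal : ℂ)) else 0

/-- `𝔼_x[e^{-q τₙ}]` for the `n`-th drawdown time without recovery. -/
def drawdownTransform {Ω : Type*} [MeasurableSpace Ω] {S : Finset ℝ} (ℙ : S → Measure Ω)
    (Y : ℝ≥0 → Ω → S) (a : ℝ) (q : ℂ) (n : ℕ) (x : S) : ℂ :=
  ∫ ω, discount q (drawdownTime Y a n ω) ∂(ℙ x)

/-- `H(q, x) = ∑_{k ≥ 1} 𝔼_x[e^{-q τₖ}]`. -/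
def drawdownSeries {Ω : Type*} [MeasurableSpace Ω] {S : Finset ℝ} (ℙ : S → Measure Ω)
    (Y : ℝ≥0 → Ω → S) (a : ℝ) (q : ℂ) (x : S) : ℂ :=
  ∑' k : ℕ, drawdownTransform ℙ Y a q (k + 1) x

/-- The payment for the `n`-th drawdown with maturity `T`, discounted at the rate `r`:
`e^{-r τₙ} 1_{τₙ < T}`. -/
def insurancePayment {Ω : Type*} {S : Finset ℝ} (Y : ℝ≥0 → Ω → S) (a r T : ℝ) (n : ℕ)
    (ω : Ω) : ℝ :=
  if drawdownTime Y a n ω < ENNReal.ofReal T then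
    Real.exp (-r * (drawdownTime Y a n ω).toReal)
  else 0

/-- The price `∑_{k ≥ 1} 𝔼_x[e^{-r τₖ} 1_{τₖ < T}]` of the drawdown insurance without recovery
with maturity `T`. -/
def insurancePrice {Ω : Type*} [MeasurableSpace Ω] {S : Finset ℝ} (ℙ : S → Measure Ω)
    (Y : ℝ≥0 → Ω → S) (a r T : ℝ) (x : S) : ℝ :=
  ∑' k : ℕ, ∫ ω, insurancePayment Y a r T (k + 1) ω ∂(ℙ x)

end

noncomputable section

/-! ### The Markov property -/

/-! Start at `x` and let `T` be the first passage time out of `(x - a, x]`. Before `T` the path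
never exceeds `x` and, at positive times, stays above `x - a`, so no drawdown of size `a` occurs. If
`T = ∞`, every drawdown time is infinite. Otherwise right-continuity puts `Y_T` outside the
interval. If `Y_T ≤ x - a`, then `T` is the first drawdown time, and drawdown `k + 1` is drawdown
`k` of the path after `T`. If `Y_T > x`, the old maximum is superseded, and drawdown `k + 1` is
drawdown `k + 1` of the path after `T` (`discount_drawdownTime_eq`).

The strong Markov property at `T` turns this into a renewal equation for `h k x = 𝔼_x[e^{-q τ_k}]`
(`IsCTMC.drawdownTransform_succ`): exits below carry `h k`, exits above carry `h (k + 1)`. The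
absolute coefficients of row `x` sum to at most `𝔼_x[e^{-Re(q) T}] < 1`, because `T > 0` almost
surely. As `S` is finite, the row sums have a common bound `ρ < 1`, and `h` decays geometrically in
the sup norm (`summable_of_renewal`). Summing over `k` with `h 0 = 1` gives the linear system.

The Laplace transform is Fubini applied to `∫ e^{-qT} e^{-rτ} 1_{τ < T} dT = e^{-(q+r)τ} / q`
(`laplace_tsum_paymentBefore`); absolute convergence follows from summability at the real rate
`Re(q) + r`.

The strong Markov property is derived from the finite-dimensional laws: first at fixed times, then
at optional times by approximation from the right on grids (`IsCTMC.map_shift_eq_prod`). -/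

lemma path_measure_ext {ι E : Type*} [MeasurableSpace E] [Countable E]
    [MeasurableSingletonClass E] {μ ν : Measure (ι → E)} [IsFiniteMeasure μ] [IsFiniteMeasure ν]
    (h : ∀ (J : Finset ι) (v : ι → E), μ {p | ∀ i ∈ J, p i = v i} = ν {p | ∀ i ∈ J, p i = v i}) :
    μ = ν := by
  classical
  rcases isEmpty_or_nonempty (ι → E) with he | ⟨⟨p₀⟩⟩
  · ext s _
    rw [Set.eq_empty_of_isEmpty s]
    simp
  refine IsProjectiveLimit.unique (P := fun J => ν.map J.restrict) (fun J => ?_) (fun J => rfl)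
  refine Measure.ext_iff_singleton.2 fun f => ?_
  have hm : Measurable (J.restrict : (ι → E) → (J → E)) := Finset.measurable_restrict J
  rw [Measure.map_apply hm (measurableSet_singleton f),
    Measure.map_apply hm (measurableSet_singleton f)]
  have hpre : (J.restrict : (ι → E) → (J → E)) ⁻¹' {f} =
      {p | ∀ i ∈ J, p i = (if hi : i ∈ J then f ⟨i, hi⟩ else p₀ i)} := by
    ext p
    simp only [Set.mem_preimage, Set.mem_singleton_iff, Set.mem_ofPred_eq, funext_iff,
      Subtype.forall]
    refine forall_congr' fun i => forall_congr' fun hi => ?_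
    simp [hi]
  rw [hpre]
  exact h J _

lemma measurableSet_cylinder_eq {ι E : Type*} [MeasurableSpace E] [MeasurableSingletonClass E]
    (J : Finset ι) (v : ι → E) : MeasurableSet {p : ι → E | ∀ i ∈ J, p i = v i} := by
  simp only [Set.ofPred_forall]
  exact Finset.measurableSet_biInter J fun i _ =>
    (measurableSet_singleton (v i)).preimage (measurable_pi_apply (X := fun _ : ι => E) i)

/-- Puts a finite set of times into the form that `finDimDistr` expects. If `0 ∈ K`, the time `0` is
listed twice, which monotonicity permits. -/
lemma exists_monotone_enumeration (K : Finset ℝ≥0) {m t : ℝ≥0} (hm : m ∈ K)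
    (hmax : ∀ k ∈ K, k ≤ m) (hmt : m ≤ t) :
    ∃ τ : ℕ → ℝ≥0, Monotone τ ∧ τ 0 = 0 ∧ (∀ i < K.card, τ (i + 1) ∈ K) ∧
      (∀ k ∈ K, ∃ i < K.card, τ (i + 1) = k) ∧ τ K.card = m ∧ τ (K.card + 1) = t := by
  let e := K.orderEmbOfFin rfl
  let τ : ℕ → ℝ≥0 := fun k => if k = 0 then 0 else
    if h : k - 1 < K.card then e ⟨k - 1, h⟩ else t
  have hτ : ∀ i (h : i < K.card), τ (i + 1) = e ⟨i, h⟩ := fun i h => by simp [τ, h]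
  have hτ' : ∀ i, K.card ≤ i → τ (i + 1) = t := fun i h => by simp [τ, h]
  have hmem : ∀ i (h : i < K.card), e ⟨i, h⟩ ∈ K := fun i h => K.orderEmbOfFin_mem rfl _
  have hsurj : ∀ k ∈ K, ∃ i < K.card, τ (i + 1) = k := by
    intro k hk
    have : k ∈ Set.range (K.orderEmbOfFin rfl) := by
      rw [Finset.range_orderEmbOfFin]; exact hk
    obtain ⟨⟨i, hi⟩, rfl⟩ := this
    exact ⟨i, hi, hτ i hi⟩
  have hmono : Monotone τ := by
    refine monotone_nat_of_le_succ fun n => ?_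
    rcases n with _ | n
    · simp [τ]
    · rcases lt_or_ge (n + 1) K.card with h | h
      · rw [hτ n (by omega), hτ (n + 1) h]
        exact e.monotone (by simp)
      · rw [hτ' (n + 1) h]
        rcases lt_or_ge n K.card with h' | h'
        · rw [hτ n h']
          exact (hmax _ (hmem n h')).trans hmt
        · rw [hτ' n h']
  refine ⟨τ, hmono, by simp [τ], fun i hi => hτ i hi ▸ hmem i hi, hsurj, ?_, hτ' _ le_rfl⟩
  obtain ⟨i, hi, him⟩ := hsurj m hm
  refine le_antisymm ?_ (him ▸ hmono (by omega))
  obtain ⟨c, hc⟩ : ∃ c, K.card = c + 1 := ⟨K.card - 1, by omega⟩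
  rw [hc, hτ c (by omega)]
  exact hmax _ (hmem c (by omega))

section

variable {Ω : Type*} [MeasurableSpace Ω] {S : Finset ℝ} {G : Matrix S S ℝ}
  {ℙ : S → Measure Ω} {Y : ℝ≥0 → Ω → S}

/-- The product formulas for `K` and for `K` followed by `t` differ only in the last factor. -/
lemma IsCTMC.measureReal_cylinder_step (hY : IsCTMC G ℙ Y) (x : S) (K : Finset ℝ≥0) {m t : ℝ≥0}
    (hm : m ∈ K) (hmax : ∀ k ∈ K, k ≤ m) (hmt : m ≤ t) (u : ℝ≥0 → S) (y : S) :
    (ℙ x).real {ω | (∀ k ∈ K, Y k ω = u k) ∧ Y t ω = y} =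
      (ℙ x).real {ω | ∀ k ∈ K, Y k ω = u k} * NormedSpace.exp (((t : ℝ) - m) • G) (u m) y := by
  obtain ⟨τ, hmono, h0, hmem, hsurj, hτm, hτt⟩ := exists_monotone_enumeration K hm hmax hmt
  have hpos : 0 < K.card := Finset.card_pos.2 ⟨m, hm⟩
  let w : ℕ → S := fun k => if k = 0 then x else if k ≤ K.card then u (τ k) else y
  have hw : ∀ i < K.card, w (i + 1) = u (τ (i + 1)) := fun i hi => by
    simp [w, Nat.succ_le_of_lt hi]
  have hwy : w (K.card + 1) = y := by simp [w]
  have hwm : w K.card = u m := by simp [w, hpos.ne', hτm]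
  have hset : {ω | ∀ k ∈ K, Y k ω = u k} =
      {ω | ∀ i < K.card, Y (τ (i + 1)) ω = w (i + 1)} := by
    ext ω
    refine ⟨fun h i hi => by rw [hw i hi]; exact h _ (hmem i hi), fun h k hk => ?_⟩
    obtain ⟨i, hi, rfl⟩ := hsurj k hk
    rw [← hw i hi]
    exact h i hi
  have hset' : {ω | (∀ k ∈ K, Y k ω = u k) ∧ Y t ω = y} =
      {ω | ∀ i < K.card + 1, Y (τ (i + 1)) ω = w (i + 1)} := by
    ext ω
    have : (∀ k ∈ K, Y k ω = u k) ↔ ∀ i < K.card, Y (τ (i + 1)) ω = w (i + 1) :=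
      Set.ext_iff.1 hset ω
    simp only [Set.mem_ofPred_eq, Order.lt_add_one_iff, this]
    constructor
    · rintro ⟨h1, h2⟩ i hi
      rcases hi.lt_or_eq with hi | rfl
      · exact h1 i hi
      · rw [hτt, hwy, h2]
    · intro h
      refine ⟨fun i hi => h i hi.le, ?_⟩
      have := h _ le_rfl
      rwa [hτt, hwy] at this
  rw [hset, hset', hY.finDimDistr x _ τ w hmono h0 (by simp [w]),
    hY.finDimDistr x _ τ w hmono h0 (by simp [w]), Finset.prod_range_succ, hτt, hτm, hwy, hwm]

/-- The σ-algebra generated by the process up to time `s`. -/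
@[reducible] def past (Y : ℝ≥0 → Ω → S) (s : ℝ≥0) : MeasurableSpace Ω :=
  MeasurableSpace.comap (fun ω (u : ℝ≥0) => Y (min u s) ω) inferInstance

lemma IsCTMC.past_le (hY : IsCTMC G ℙ Y) (s : ℝ≥0) : past Y s ≤ ‹MeasurableSpace Ω› := by
  rintro _ ⟨B, hB, rfl⟩
  exact (measurable_pi_lambda _ fun u => hY.measurable (min u s)) hB

omit [MeasurableSpace Ω] in
lemma measurable_past {s u : ℝ≥0} (h : u ≤ s) : Measurable[past Y s] (Y u) := by
  have h1 : Measurable[past Y s] (fun ω (u : ℝ≥0) => Y (min u s) ω) := comap_measurable _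
  have h2 := (measurable_pi_apply (X := fun _ : ℝ≥0 => S) u).comp h1
  have h3 : (fun b : ℝ≥0 → S => b u) ∘ (fun ω (u : ℝ≥0) => Y (min u s) ω) = Y u := by
    funext ω
    simp [h]
  rwa [h3] at h2

omit [MeasurableSpace Ω] in
lemma past_mono {s t : ℝ≥0} (h : s ≤ t) : past Y s ≤ past Y t := by
  rintro _ ⟨B, hB, rfl⟩
  have : @Measurable _ _ (past Y t) _ (fun ω (u : ℝ≥0) => Y (min u s) ω) :=
    @measurable_pi_lambda _ _ _ (past Y t) _ _
      (fun u => measurable_past ((min_le_right u s).trans h))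
  exact this hB

lemma IsCTMC.measurableSet_eq (hY : IsCTMC G ℙ Y) (t : ℝ≥0) (y : S) :
    MeasurableSet {ω | Y t ω = y} :=
  hY.measurable t (measurableSet_singleton y)

/-- Both sides are finite measures of the set of stopped paths that defines `A`, so it suffices to
compare them on cylinders, where the previous lemma applies. -/
lemma IsCTMC.measure_inter_step (hY : IsCTMC G ℙ Y) (x : S) {m t : ℝ≥0} (hmt : m ≤ t)
    {A : Set Ω} (hA : MeasurableSet[past Y m] A) (z y : S) :
    ℙ x (A ∩ {ω | Y m ω = z} ∩ {ω | Y t ω = y}) =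
      ℙ x (A ∩ {ω | Y m ω = z}) *
        ENNReal.ofReal (NormedSpace.exp (((t : ℝ) - m) • G) z y) := by
  have := hY.isProbabilityMeasure x
  obtain ⟨B, hB, rfl⟩ := hA
  set c := ENNReal.ofReal (NormedSpace.exp (((t : ℝ) - m) • G) z y) with hc
  set Φ : Ω → ℝ≥0 → S := fun ω u => Y (min u m) ω with hΦ
  have hΦm : Measurable Φ := measurable_pi_lambda _ fun u => hY.measurable (min u m)
  have key : ((ℙ x).restrict ({ω | Y m ω = z} ∩ {ω | Y t ω = y})).map Φ =
      c.toNNReal • ((ℙ x).restrict {ω | Y m ω = z}).map Φ := by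
    refine path_measure_ext fun J v => ?_
    have hC : MeasurableSet {p : ℝ≥0 → S | ∀ i ∈ J, p i = v i} := by
      exact measurableSet_cylinder_eq J v
    rw [Measure.smul_apply, Measure.map_apply hΦm hC, Measure.map_apply hΦm hC,
      Measure.restrict_apply (hΦm hC), Measure.restrict_apply (hΦm hC)]
    -- Several indices of `J` may be truncated to the same time `m`, with conflicting values of `v`;
    -- the cylinder is then empty. Otherwise any of its points `ω₀` supplies consistent values.
    by_cases hne : (Φ ⁻¹' {p | ∀ i ∈ J, p i = v i} ∩ {ω | Y m ω = z}).Nonempty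
    · obtain ⟨ω₀, h₀, h₀z⟩ := hne
      set K := insert m (J.image fun i => min i m) with hK
      have hset : Φ ⁻¹' {p | ∀ i ∈ J, p i = v i} ∩ {ω | Y m ω = z} =
          {ω | ∀ k ∈ K, Y k ω = Y k ω₀} := by
        ext ω
        simp only [Set.mem_inter_iff, Set.mem_preimage, Set.mem_ofPred_eq, hK,
          Finset.forall_mem_insert, Finset.forall_mem_image, hΦ] at h₀ h₀z ⊢
        rw [h₀z, and_comm]
        exact and_congr_right fun _ => forall_congr' fun i => forall_congr' fun hi => by
          rw [h₀ i hi]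
      have := hY.measureReal_cylinder_step x K (m := m) (t := t) (by simp [hK])
        (by simp [hK]) hmt (fun k => Y k ω₀) y
      have h₀z' : Y m ω₀ = z := h₀z
      rw [h₀z', ← hset] at this
      rw [← Set.inter_assoc, hset]
      rw [hset] at this
      rw [← ofReal_measureReal, ← ofReal_measureReal]
      have hset2 : {ω | ∀ k ∈ K, Y k ω = Y k ω₀} ∩ {ω | Y t ω = y} =
        {ω | (∀ k ∈ K, Y k ω = Y k ω₀) ∧ Y t ω = y} := rfl
      rw [hset2, this, ENNReal.ofReal_mul measureReal_nonneg, mul_comm, hc]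
      simp [ENNReal.smul_def, ENNReal.ofReal]
    · rw [Set.not_nonempty_iff_eq_empty] at hne
      rw [← Set.inter_assoc, hne]
      simp
  have := congrArg (fun μ => μ B) key
  simp only [Measure.smul_apply] at this
  rw [Measure.map_apply hΦm hB, Measure.map_apply hΦm hB, Measure.restrict_apply (hΦm hB),
    Measure.restrict_apply (hΦm hB), ← Set.inter_assoc] at this
  rw [this, mul_comm]
  simp [hc, ENNReal.smul_def, ENNReal.ofReal]

omit [MeasurableSpace Ω] in
lemma measurableSet_past_eq {s u : ℝ≥0} (h : u ≤ s) (y : S) :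
    MeasurableSet[past Y s] {ω | Y u ω = y} :=
  measurable_past h (measurableSet_singleton y)

/-- The Markov property at a fixed time, for cylinders in the future. -/
lemma IsCTMC.measure_inter_cylinder (hY : IsCTMC G ℙ Y) (x : S) (s : ℝ≥0)
    {A : Set Ω} (hA : MeasurableSet[past Y s] A) (y : S) (J : Finset ℝ≥0) (v : ℝ≥0 → S) :
    ℙ x (A ∩ {ω | Y s ω = y} ∩ {ω | ∀ j ∈ J, Y (s + j) ω = v j}) =
      ℙ x (A ∩ {ω | Y s ω = y}) * ℙ y {ω | ∀ j ∈ J, Y j ω = v j} := by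
  have := hY.isProbabilityMeasure
  induction J using Finset.induction_on_max with
  | empty => simp
  | insert j J hj ih =>
    rcases J.eq_empty_or_nonempty with rfl | hJ
    · have h1 : ℙ y {ω | Y j ω = v j} =
          ENNReal.ofReal (NormedSpace.exp (((j : ℝ) - (0 : ℝ≥0)) • G) y (v j)) := by
        have h2 := hY.measure_inter_step y (zero_le : 0 ≤ j) (A := Set.univ) (z := y)
          (@MeasurableSet.univ _ (past Y 0)) (v j)
        have h3 : ℙ y {ω | Y 0 ω = y} = 1 := by
          rw [prob_compl_eq_zero_iff (hY.measurableSet_eq 0 y) |>.symm]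
          exact hY.start y
        rw [Set.univ_inter, h3, one_mul] at h2
        rw [← h2, Set.inter_comm]
        refine (measure_inter_conull ?_).symm
        exact hY.start y
      have := hY.measure_inter_step x (le_self_add : s ≤ s + j) hA y (v j)
      simp only [insert_empty_eq, Finset.mem_singleton, forall_eq, this, h1]
      simp
    -- The new time `j` is the latest. The rest of the cylinder belongs to the past of `s + m` and
    -- fixes the state there, so both sides gain the same transition factor from `m` to `j`.
    · set m := J.max' hJ with hm
      have hmJ : m ∈ J := J.max'_mem hJ
      have hmax : ∀ i ∈ J, i ≤ m := fun i hi => J.le_max' i hi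
      have hmj : m ≤ j := (hj m hmJ).le
      have hcyl : ∀ (c : ℝ≥0), {ω | ∀ i ∈ insert j J, Y (c + i) ω = v i} =
          {ω | ∀ i ∈ J, Y (c + i) ω = v i} ∩ {ω | Y (c + m) ω = v m} ∩
            {ω | Y (c + j) ω = v j} := by
        intro c
        ext ω
        simp only [Finset.forall_mem_insert, Set.mem_ofPred_eq, Set.mem_inter_iff]
        exact ⟨fun h => ⟨⟨h.2, h.2 m hmJ⟩, h.1⟩, fun h => ⟨h.2, h.1.1⟩⟩
      have hcyl' : ∀ (c : ℝ≥0), {ω | ∀ i ∈ J, Y (c + i) ω = v i} ∩ {ω | Y (c + m) ω = v m} =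
          {ω | ∀ i ∈ J, Y (c + i) ω = v i} := fun c =>
        Set.inter_eq_left.2 fun ω h => h m hmJ
      have hmeas : ∀ c : ℝ≥0,
          MeasurableSet[past Y (c + m)] {ω | ∀ i ∈ J, Y (c + i) ω = v i} := by
        intro c
        simp only [Set.ofPred_forall]
        exact Finset.measurableSet_biInter J fun i hi =>
          measurableSet_past_eq (by gcongr; exact hmax i hi) (v i)
      have h1 := hY.measure_inter_step y hmj (A := {ω | ∀ i ∈ J, Y (0 + i) ω = v i})
        (by have := hmeas 0; rwa [zero_add] at this) (v m) (v j)
      have hA' : MeasurableSet[past Y (s + m)]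
          (A ∩ {ω | Y s ω = y} ∩ {ω | ∀ i ∈ J, Y (s + i) ω = v i}) :=
        ((past_mono le_self_add _ hA).inter (measurableSet_past_eq le_self_add y)).inter
          (hmeas s)
      have h2 := hY.measure_inter_step x (by gcongr : s + m ≤ s + j) hA' (v m) (v j)
      have hc0 := hcyl 0
      have hc0' := hcyl' 0
      simp only [zero_add] at hc0 hc0' h1
      rw [hc0, h1, hc0', hcyl s, ← Set.inter_assoc, ← Set.inter_assoc, h2,
        Set.inter_assoc (A ∩ {ω | Y s ω = y}), hcyl' s, ih, mul_assoc]
      simp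

end

/-! ### The strong Markov property at optional times -/

section
open Filter Topology

variable {Ω : Type*} [MeasurableSpace Ω] {S : Finset ℝ} {G : Matrix S S ℝ}
  {ℙ : S → Measure Ω} {Y : ℝ≥0 → Ω → S}

omit [MeasurableSpace Ω] in
lemma eventually_eq_of_rightContinuous {E : Type*} [TopologicalSpace E] [DiscreteTopology E]
    {p : ℝ≥0 → E} {t : ℝ≥0} (h : ContinuousWithinAt p (Set.Ici t) t) :
    ∀ᶠ s in 𝓝[≥] t, p s = p t := by
  have := h.tendsto
  rwa [nhds_discrete, tendsto_pure] at this

/-- The approximation of a time `τ` from the right by the grid of mesh `1 / (m + 1)`. -/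
def gridAbove (m : ℕ) (τ : ℝ≥0) : ℝ≥0 := ((⌊(m + 1) * τ⌋₊ + 1 : ℕ) : ℝ≥0) / (m + 1)

lemma lt_gridAbove (m : ℕ) (τ : ℝ≥0) : τ < gridAbove m τ := by
  rw [gridAbove, lt_div_iff₀ (by positivity), mul_comm]
  exact_mod_cast Nat.lt_floor_add_one _

lemma gridAbove_le (m : ℕ) (τ : ℝ≥0) : gridAbove m τ ≤ τ + 1 / (m + 1) := by
  have h : (⌊(m + 1) * τ⌋₊ : ℝ≥0) ≤ (m + 1) * τ := Nat.floor_le zero_le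
  rw [gridAbove, div_le_iff₀ (by positivity)]
  push_cast
  calc (⌊(m + 1) * τ⌋₊ : ℝ≥0) + 1 ≤ (m + 1) * τ + 1 := by gcongr
    _ = (τ + 1 / (m + 1)) * (m + 1) := by field_simp

lemma tendsto_gridAbove (τ t : ℝ≥0) :
    Tendsto (fun m => gridAbove m τ + t) atTop (𝓝[≥] (τ + t)) := by
  refine tendsto_nhdsWithin_iff.2 ⟨?_, Eventually.of_forall fun m => ?_⟩
  · refine Tendsto.add_const t ?_
    refine tendsto_of_tendsto_of_tendsto_of_le_of_le tendsto_const_nhds (h := fun m : ℕ =>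
      τ + 1 / ((m : ℝ≥0) + 1)) ?_ (fun m => (lt_gridAbove m τ).le) (fun m => gridAbove_le m τ)
    have : Tendsto (fun m : ℕ => 1 / ((m : ℝ≥0) + 1)) atTop (𝓝 0) :=
      tendsto_one_div_add_atTop_nhds_zero_nat
    simpa using this.const_add τ
  · have := (lt_gridAbove m τ).le
    exact add_le_add_left this t

omit [MeasurableSpace Ω] in
lemma eventually_gridAbove_eq {p : ℝ≥0 → S}
    (h : ∀ t, ContinuousWithinAt p (Set.Ici t) t) (τ t : ℝ≥0) :
    ∀ᶠ m in atTop, p (gridAbove m τ + t) = p (τ + t) :=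
  (tendsto_gridAbove τ t).eventually (eventually_eq_of_rightContinuous (h _))

/-- `T` is an optional time of the process `Y`: the event `T < s` is determined by the process up
to time `s`. -/
def IsOptionalTime (Y : ℝ≥0 → Ω → S) (T : Ω → ℝ≥0∞) : Prop :=
  ∀ s : ℝ≥0, MeasurableSet[past Y s] {ω | T ω < s}

lemma IsOptionalTime.measurable {T : Ω → ℝ≥0∞} (hT : IsOptionalTime Y T)
    (hY : IsCTMC G ℙ Y) : Measurable T := by
  refine measurable_of_Iio fun c => ?_
  have hfin : ∀ s : ℝ≥0, MeasurableSet {ω | T ω < s} := fun s => hY.past_le s _ (hT s)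
  induction c with
  | top =>
    have : T ⁻¹' Set.Iio ⊤ = ⋃ n : ℕ, {ω | T ω < (n : ℝ≥0)} := by
      ext ω
      simp only [Set.mem_preimage, Set.mem_Iio, Set.mem_iUnion, Set.mem_ofPred_eq,
        ENNReal.coe_natCast]
      exact ⟨fun h => ENNReal.exists_nat_gt h.ne, fun ⟨n, hn⟩ => hn.trans (by simp)⟩
    rw [this]
    exact MeasurableSet.iUnion fun n => hfin n
  | coe c => exact hfin c

lemma IsCTMC.measurable_at_countable (hY : IsCTMC G ℙ Y) (s : ℕ → ℝ≥0) {N : Ω → ℕ}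
    (hN : Measurable N) : Measurable fun ω => Y (s (N ω)) ω := by
  have h : Measurable fun z : Ω × ℕ => Y (s z.2) z.1 :=
    measurable_from_prod_countable_left fun n => hY.measurable (s n)
  exact h.comp (measurable_id.prodMk hN)

lemma measurable_grid_floor {τ : Ω → ℝ≥0} (hτ : Measurable τ) (m : ℕ) :
    Measurable fun ω => ⌊((m : ℝ≥0) + 1) * τ ω⌋₊ :=
  Nat.measurable_floor.comp (hτ.const_mul _)

lemma IsCTMC.measurable_at_gridAbove (hY : IsCTMC G ℙ Y) {τ : Ω → ℝ≥0} (hτ : Measurable τ)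
    (m : ℕ) (t : ℝ≥0) : Measurable fun ω => Y (gridAbove m (τ ω) + t) ω :=
  hY.measurable_at_countable (fun n => ((n + 1 : ℕ) : ℝ≥0) / (m + 1) + t)
    (measurable_grid_floor hτ m)

lemma IsCTMC.measurable_shift (hY : IsCTMC G ℙ Y) {τ : Ω → ℝ≥0} (hτ : Measurable τ) :
    Measurable fun ω (t : ℝ≥0) => Y (τ ω + t) ω := by
  refine measurable_pi_lambda _ fun t => ?_
  refine measurable_of_tendsto_metrizable (hY.measurable_at_gridAbove hτ · t) ?_
  refine tendsto_pi_nhds.2 fun ω => tendsto_const_nhds.congr' ?_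
  filter_upwards [eventually_gridAbove_eq (hY.rightContinuous ω) (τ ω) t] with m hm
  exact hm.symm

omit [MeasurableSpace Ω] in
-- The floor equals `j` exactly when `T` lies in a half-open mesh interval, so the event is a
-- difference of events `T < ·`, decided by the right endpoint. This is why the grid approximation
-- lies strictly to the right of `T`.
lemma IsOptionalTime.measurableSet_grid {T : Ω → ℝ≥0∞} (hT : IsOptionalTime Y T) (r : ℝ≥0)
    (m j : ℕ) : MeasurableSet[past Y (((j + 1 : ℕ) : ℝ≥0) / (m + 1))]
      ({ω | T ω < r} ∩ {ω | ⌊(m + 1) * (T ω).toNNReal⌋₊ = j}) := by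
  set s : ℝ≥0 := ((j + 1 : ℕ) : ℝ≥0) / (m + 1) with hs
  set s' : ℝ≥0 := (j : ℝ≥0) / (m + 1) with hs'
  have hset : {ω | T ω < r} ∩ {ω | ⌊(m + 1) * (T ω).toNNReal⌋₊ = j} =
      {ω | T ω < (min r s : ℝ≥0)} \ {ω | T ω < s'} := by
    ext ω
    simp only [Set.mem_inter_iff, Set.mem_ofPred_eq, Set.mem_sdiff]
    rcases eq_or_ne (T ω) ⊤ with h | h
    · simp [h]
    · lift T ω to ℝ≥0 using h with τ
      simp only [ENNReal.coe_lt_coe, ENNReal.toNNReal_coe, lt_min_iff, not_lt, and_assoc]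
      refine and_congr_right fun _ => ?_
      rw [Nat.floor_eq_iff zero_le, hs, hs', lt_div_iff₀ (by positivity),
        div_le_iff₀ (by positivity), mul_comm τ, and_comm]
      push_cast
      rfl
  rw [hset]
  refine MeasurableSet.diff (past_mono (min_le_right r s) _ (hT _))
    (past_mono ?_ _ (hT _))
  rw [hs, hs']
  gcongr
  simp

/-- The approximating time takes countably many values; the fixed-time Markov property holds on each
piece. -/
lemma IsCTMC.measure_optional_grid (hY : IsCTMC G ℙ Y) {T : Ω → ℝ≥0∞} (hT : IsOptionalTime Y T)
    (x y : S) (r : ℝ≥0) (m : ℕ) (J : Finset ℝ≥0) (v : ℝ≥0 → S) :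
    ℙ x ({ω | T ω < r} ∩ {ω | Y (gridAbove m (T ω).toNNReal) ω = y} ∩
        {ω | ∀ j ∈ J, Y (gridAbove m (T ω).toNNReal + j) ω = v j}) =
      ℙ x ({ω | T ω < r} ∩ {ω | Y (gridAbove m (T ω).toNNReal) ω = y}) *
        ℙ y {ω | ∀ j ∈ J, Y j ω = v j} := by
  set N : Ω → ℕ := fun ω => ⌊(m + 1) * (T ω).toNNReal⌋₊ with hN
  set g : ℕ → ℝ≥0 := fun j => ((j + 1 : ℕ) : ℝ≥0) / (m + 1) with hg
  have hgrid : ∀ ω, gridAbove m (T ω).toNNReal = g (N ω) := fun ω => rfl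
  have hA : ∀ j, MeasurableSet[past Y (g j)] ({ω | T ω < r} ∩ {ω | N ω = j}) :=
    hT.measurableSet_grid r m
  have hAm := fun j => hY.past_le _ _ (hA j)
  have hcyl : ∀ s : ℝ≥0, MeasurableSet {ω | ∀ i ∈ J, Y (s + i) ω = v i} := fun s => by
    simp only [Set.ofPred_forall]
    exact Finset.measurableSet_biInter J fun i _ => hY.measurableSet_eq _ _
  have hsum : ∀ B : ℕ → Set Ω, (∀ j, MeasurableSet (B j)) →
      ℙ x ({ω | T ω < r} ∩ {ω | ω ∈ B (N ω)}) =
        ∑' j, ℙ x ({ω | T ω < r} ∩ {ω | N ω = j} ∩ B j) := by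
    intro B hB
    rw [← measure_iUnion]
    · congr 1
      ext ω
      simp only [Set.mem_inter_iff, Set.mem_iUnion, Set.mem_ofPred_eq]
      exact ⟨fun h => ⟨N ω, ⟨h.1, rfl⟩, h.2⟩, by rintro ⟨j, ⟨h1, rfl⟩, h2⟩; exact ⟨h1, h2⟩⟩
    · intro i j hij
      refine Set.disjoint_left.2 ?_
      rintro ω ⟨⟨-, h1⟩, -⟩ ⟨⟨-, h2⟩, -⟩
      exact hij (h1.symm.trans h2)
    · exact fun j => (hAm j).inter (hB j)
  have h1 := hsum (fun j => {ω | Y (g j) ω = y} ∩ {ω | ∀ i ∈ J, Y (g j + i) ω = v i})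
    fun j => (hY.measurableSet_eq _ _).inter (hcyl _)
  have h2 := hsum (fun j => {ω | Y (g j) ω = y}) fun j => hY.measurableSet_eq _ _
  simp only [hgrid]
  rw [Set.inter_assoc]
  refine h1.trans ?_
  refine Eq.trans ?_ (congrArg (· * ℙ y {ω | ∀ j ∈ J, Y j ω = v j}) h2.symm)
  rw [← ENNReal.tsum_mul_right]
  refine tsum_congr fun j => ?_
  rw [← Set.inter_assoc]
  exact hY.measure_inter_cylinder x (g j) (hA j) y J v

/-- Refine the mesh: the states are discrete and the paths right-continuous, so each indicator is
eventually constant and the measures converge. -/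
lemma IsCTMC.measure_optional_cylinder (hY : IsCTMC G ℙ Y) {T : Ω → ℝ≥0∞}
    (hT : IsOptionalTime Y T) (x y : S) (r : ℝ≥0) (J : Finset ℝ≥0) (v : ℝ≥0 → S) :
    ℙ x ({ω | T ω < r} ∩ {ω | Y (T ω).toNNReal ω = y} ∩
        {ω | ∀ j ∈ J, Y ((T ω).toNNReal + j) ω = v j}) =
      ℙ x ({ω | T ω < r} ∩ {ω | Y (T ω).toNNReal ω = y}) *
        ℙ y {ω | ∀ j ∈ J, Y j ω = v j} := by
  have := hY.isProbabilityMeasure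
  have hτ : Measurable fun ω => (T ω).toNNReal := (hT.measurable hY).ennreal_toNNReal
  have hm := fun (m : ℕ) (t : ℝ≥0) => hY.measurable_at_gridAbove hτ m t
  have hr : MeasurableSet {ω | T ω < r} := hY.past_le r _ (hT r)
  have hev := fun (ω : Ω) (t : ℝ≥0) =>
    eventually_gridAbove_eq (hY.rightContinuous ω) (T ω).toNNReal t
  have hy : ∀ m, MeasurableSet {ω | Y (gridAbove m (T ω).toNNReal) ω = y} := fun m => by
    have := hm m 0
    simp only [add_zero] at this
    exact this (measurableSet_singleton y)
  have hl := tendsto_measure_of_tendsto_indicator_of_isFiniteMeasure atTop (ℙ x)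
    (As := fun m => {ω | T ω < r} ∩ {ω | Y (gridAbove m (T ω).toNNReal) ω = y} ∩
        {ω | ∀ j ∈ J, Y (gridAbove m (T ω).toNNReal + j) ω = v j})
    (A := {ω | T ω < r} ∩ {ω | Y (T ω).toNNReal ω = y} ∩
        {ω | ∀ j ∈ J, Y ((T ω).toNNReal + j) ω = v j})
    (fun m => (hr.inter (hy m)).inter (by
      simp only [Set.ofPred_forall]
      exact Finset.measurableSet_biInter J fun j _ =>
        hm m j (measurableSet_singleton (v j))))
    (fun ω => by
      have h0 := hev ω 0
      simp only [add_zero] at h0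
      filter_upwards [h0, (Filter.eventually_all_finset J).2 fun j _ => hev ω j] with m h1 h2
      simp only [Set.mem_inter_iff, Set.mem_ofPred_eq, h1]
      exact and_congr_right fun _ => forall_congr' fun j => forall_congr' fun hj => by
        rw [h2 j hj])
  have hr' := tendsto_measure_of_tendsto_indicator_of_isFiniteMeasure atTop (ℙ x)
    (As := fun m => {ω | T ω < r} ∩ {ω | Y (gridAbove m (T ω).toNNReal) ω = y})
    (A := {ω | T ω < r} ∩ {ω | Y (T ω).toNNReal ω = y})
    (fun m => hr.inter (hy m))
    (fun ω => by
      have h0 := hev ω 0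
      simp only [add_zero] at h0
      filter_upwards [h0] with m h1
      simp only [Set.mem_inter_iff, Set.mem_ofPred_eq, h1])
  refine tendsto_nhds_unique hl ?_
  simp only [hY.measure_optional_grid hT x y r _ J v]
  exact ENNReal.Tendsto.mul_const hr' (Or.inr (measure_ne_top _ _))

lemma IsCTMC.measurable_path (hY : IsCTMC G ℙ Y) : Measurable fun ω (t : ℝ≥0) => Y t ω :=
  measurable_pi_lambda _ hY.measurable

/-- The strong Markov property: on the event `T < ∞, Y_T = y`, the process after the optional time
`T` is independent of `T` and distributed like the process started at `y`. -/
lemma IsCTMC.map_shift_eq_prod (hY : IsCTMC G ℙ Y) {T : Ω → ℝ≥0∞} (hT : IsOptionalTime Y T)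
    (x y : S) :
    ((ℙ x).restrict ({ω | T ω < ∞} ∩ {ω | Y (T ω).toNNReal ω = y})).map
        (fun ω => ((T ω).toNNReal, fun t : ℝ≥0 => Y ((T ω).toNNReal + t) ω)) =
      (((ℙ x).restrict ({ω | T ω < ∞} ∩ {ω | Y (T ω).toNNReal ω = y})).map
        (fun ω => (T ω).toNNReal)).prod ((ℙ y).map fun ω (t : ℝ≥0) => Y t ω) := by
  have := hY.isProbabilityMeasure
  set E := {ω | T ω < ∞} ∩ {ω | Y (T ω).toNNReal ω = y} with hE
  have hτ : Measurable fun ω => (T ω).toNNReal := (hT.measurable hY).ennreal_toNNReal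
  have hΘ := hY.measurable_shift hτ
  have hΦ := hY.measurable_path
  have hprob : IsProbabilityMeasure ((ℙ y).map fun ω (t : ℝ≥0) => Y t ω) :=
    Measure.isProbabilityMeasure_map hΦ.aemeasurable
  -- `toNNReal` sends `∞` to `0`, so the intersection with `E` is needed to discard `T = ∞`.
  have hEr : ∀ r : ℝ≥0, {ω | (T ω).toNNReal < r} ∩ E =
      {ω | T ω < r} ∩ {ω | Y (T ω).toNNReal ω = y} := by
    intro r
    ext ω
    simp only [hE, Set.mem_inter_iff, Set.mem_ofPred_eq, ← and_assoc]
    refine and_congr_left fun _ => ?_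
    rcases eq_or_ne (T ω) ⊤ with h | h
    · simp [h]
    · lift T ω to ℝ≥0 using h with τ
      simp
  symm
  refine Measure.prod_eq_generateFrom (C := Set.range Set.Iio)
    ((borel_eq_generateFrom_Iio ℝ≥0).symm.trans BorelSpace.measurable_eq.symm)
    MeasurableSpace.generateFrom_measurableSet isPiSystem_Iio
    MeasurableSpace.isPiSystem_measurableSet
    ⟨fun n : ℕ => Set.Iio (n : ℝ≥0), fun n => ⟨_, rfl⟩, fun n => measure_lt_top _ _, ?_⟩
    (Measure.toFiniteSpanningSetsIn _) ?_
  · refine Set.eq_univ_of_forall fun t => ?_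
    obtain ⟨n, hn⟩ := exists_nat_gt t
    exact Set.mem_iUnion.2 ⟨n, hn⟩
  · rintro _ ⟨r, rfl⟩ C hC
    rw [Measure.map_apply (hτ.prodMk hΘ) (measurableSet_Iio.prod hC),
      Measure.map_apply hτ measurableSet_Iio,
      Measure.restrict_apply (hτ measurableSet_Iio),
      Measure.restrict_apply ((hτ.prodMk hΘ) (measurableSet_Iio.prod hC))]
    set c := ℙ x ({ω | T ω < r} ∩ {ω | Y (T ω).toNNReal ω = y}) with hc
    have key : ((ℙ x).restrict ({ω | T ω < r} ∩ {ω | Y (T ω).toNNReal ω = y})).map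
        (fun ω (t : ℝ≥0) => Y ((T ω).toNNReal + t) ω) =
        c.toNNReal • (ℙ y).map fun ω (t : ℝ≥0) => Y t ω := by
      refine path_measure_ext fun J v => ?_
      have hJ := measurableSet_cylinder_eq J v
      rw [Measure.smul_apply, Measure.map_apply hΘ hJ, Measure.map_apply hΦ hJ,
        Measure.restrict_apply (hΘ hJ), ENNReal.smul_def, smul_eq_mul,
        ENNReal.coe_toNNReal (measure_ne_top _ _), Set.inter_comm]
      exact hY.measure_optional_cylinder hT x y r J v
    have := congrArg (fun μ => μ C) key
    simp only [Measure.smul_apply] at this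
    rw [Measure.map_apply hΘ hC, Measure.restrict_apply (hΘ hC), ENNReal.smul_def, smul_eq_mul,
        ENNReal.coe_toNNReal (measure_ne_top _ _)] at this
    have h1 : (fun ω => (T ω).toNNReal) ⁻¹' Set.Iio r ∩ E = {ω | (T ω).toNNReal < r} ∩ E := rfl
    rw [h1, hEr, ← hc, ← this, ← hEr]
    congr 1
    ext ω
    simp only [Set.mem_inter_iff, Set.mem_preimage, Set.mem_prod, Set.mem_Iio,
      Set.mem_ofPred_eq]
    tauto

lemma IsCTMC.setIntegral_mul_shift (hY : IsCTMC G ℙ Y) {T : Ω → ℝ≥0∞} (hT : IsOptionalTime Y T)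
    (x y : S) {f : ℝ≥0 → ℂ} {g : (ℝ≥0 → S) → ℂ} (hf : Measurable f) (hg : Measurable g) :
    ∫ ω in {ω | T ω < ∞} ∩ {ω | Y (T ω).toNNReal ω = y},
        f (T ω).toNNReal * g (fun t => Y ((T ω).toNNReal + t) ω) ∂(ℙ x) =
      (∫ ω in {ω | T ω < ∞} ∩ {ω | Y (T ω).toNNReal ω = y}, f (T ω).toNNReal ∂(ℙ x)) *
        ∫ ω, g (fun t => Y t ω) ∂(ℙ y) := by
  have := hY.isProbabilityMeasure
  have hτ : Measurable fun ω => (T ω).toNNReal := (hT.measurable hY).ennreal_toNNReal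
  have hΘ := hY.measurable_shift hτ
  have h1 := integral_map (μ := (ℙ x).restrict ({ω | T ω < ∞} ∩ {ω | Y (T ω).toNNReal ω = y}))
    (hτ.prodMk hΘ).aemeasurable (f := fun z => f z.1 * g z.2)
    ((hf.comp measurable_fst).mul (hg.comp measurable_snd)).aestronglyMeasurable
  rw [← h1, hY.map_shift_eq_prod hT, integral_prod_mul f g,
    integral_map hτ.aemeasurable hf.aestronglyMeasurable,
    integral_map hY.measurable_path.aemeasurable hg.aestronglyMeasurable]

end

/-! ### First passage and drawdown times of right-continuous paths -/

section
open Filter Topology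

variable {Ω : Type*} {S : Finset ℝ}

/-- An enumeration of a countable dense set of times. -/
def gridPoint (i : ℕ × ℕ) : ℝ≥0 := ((i.2 + 1 : ℕ) : ℝ≥0) / (i.1 + 1)

lemma gridPoint_pos (i : ℕ × ℕ) : 0 < gridPoint i := by
  unfold gridPoint
  positivity

/-- Every state of the path recurs at grid times immediately afterwards; this reduces infima over
all times to countable ones. -/
lemma exists_gridPoint {p : ℝ≥0 → S} (h : ∀ t, ContinuousWithinAt p (Set.Ici t) t)
    {t s : ℝ≥0} (hts : t < s) : ∃ i, t < gridPoint i ∧ gridPoint i < s ∧ p (gridPoint i) = p t := by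
  have h1 := eventually_gridAbove_eq h t 0
  have h2 : ∀ᶠ m in atTop, gridAbove m t + 0 < s :=
    ((tendsto_gridAbove t 0).mono_right nhdsWithin_le_nhds).eventually
      (gt_mem_nhds (by simpa using hts))
  obtain ⟨m, hm, hm'⟩ := (h1.and h2).exists
  simp only [add_zero] at hm hm'
  exact ⟨(m, ⌊(m + 1) * t⌋₊), lt_gridAbove m t, hm', hm⟩

lemma firstPassageTime_lt_iff {Y : ℝ≥0 → Ω → S} {ω : Ω}
    (h : ∀ t, ContinuousWithinAt (fun s => Y s ω) (Set.Ici t) t) (A : Set ℝ) (s : ℝ≥0) :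
    firstPassageTime Y A ω < s ↔ ∃ i, gridPoint i < s ∧ (Y (gridPoint i) ω : ℝ) ∉ A := by
  simp only [firstPassageTime, iInf_lt_iff]
  constructor
  · rintro ⟨t, ⟨-, htA⟩, hts⟩
    obtain ⟨i, -, his, hi⟩ := exists_gridPoint h (ENNReal.coe_lt_coe.1 hts)
    exact ⟨i, his, by rwa [hi]⟩
  · rintro ⟨i, his, hi⟩
    exact ⟨gridPoint i, ⟨gridPoint_pos i, hi⟩, ENNReal.coe_lt_coe.2 his⟩

lemma isOptionalTime_firstPassageTime {Y : ℝ≥0 → Ω → S}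
    (h : ∀ ω t, ContinuousWithinAt (fun s => Y s ω) (Set.Ici t) t) (A : Set ℝ) :
    IsOptionalTime Y (firstPassageTime Y A) := by
  intro s
  simp only [firstPassageTime_lt_iff (h _), Set.ofPred_exists]
  refine MeasurableSet.iUnion fun i => ?_
  by_cases hi : gridPoint i < s
  · simp only [hi, true_and]
    exact measurable_past hi.le (MeasurableSet.of_discrete (s := {y : S | (y : ℝ) ∉ A}))
  · simp [hi]

lemma coe_mem_of_lt_firstPassageTime {Y : ℝ≥0 → Ω → S} {A : Set ℝ} {ω : Ω} {t : ℝ≥0}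
    (ht : 0 < t) (h : t < firstPassageTime Y A ω) : (Y t ω : ℝ) ∈ A := by
  by_contra hA
  exact (iInf₂_le t ⟨ht, hA⟩ : firstPassageTime Y A ω ≤ t).not_gt h

/-- Were the state at `T` in `A`, the path would keep it on some `[T, b)`, delaying the exit to at
least `b > T`. -/
lemma coe_firstPassageTime_notMem {Y : ℝ≥0 → Ω → S} {A : Set ℝ} {ω : Ω} {T : ℝ≥0}
    (h : ∀ t, ContinuousWithinAt (fun s => Y s ω) (Set.Ici t) t)
    (hT : firstPassageTime Y A ω = T) : (Y T ω : ℝ) ∉ A := by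
  intro hA
  have h1 := eventually_eq_of_rightContinuous (h T)
  obtain ⟨b, hb, hbI⟩ := mem_nhdsGE_iff_exists_Ico_subset.1 h1
  have hb' : T < b := hb
  have : (b : ℝ≥0∞) ≤ firstPassageTime Y A ω := by
    refine le_iInf₂ fun t ht => ?_
    by_contra htb
    rw [not_le, ENNReal.coe_lt_coe] at htb
    rcases lt_or_ge t T with htT | htT
    · exact ht.2 (coe_mem_of_lt_firstPassageTime ht.1 (by rw [hT]; exact_mod_cast htT))
    · have h2 : Y t ω = Y T ω := hbI ⟨htT, htb⟩
      exact ht.2 (h2 ▸ hA)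
  rw [hT, ENNReal.coe_le_coe] at this
  exact this.not_gt hb'

/-! ### Drawdown times as functionals of the path -/

lemma le_runningSup_sub_iff {Y : ℝ≥0 → Ω → S} {ω : Ω} {s : ℝ≥0∞} {t : ℝ≥0} (hst : s ≤ t)
    (a : ℝ) : a ≤ runningSup Y s t ω - (Y t ω : ℝ) ↔
      ∃ u : ℝ≥0, s ≤ u ∧ u ≤ t ∧ a ≤ (Y u ω : ℝ) - Y t ω := by
  have hfin : ((fun u : ℝ≥0 => (Y u ω : ℝ)) '' {u : ℝ≥0 | s ≤ u ∧ u ≤ t}).Finite :=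
    S.finite_toSet.subset (by rintro _ ⟨u, -, rfl⟩; exact (Y u ω).2)
  constructor
  · intro h
    -- The supremum is attained because the set of values is finite and nonempty.
    have hne : ((fun u : ℝ≥0 => (Y u ω : ℝ)) '' {u : ℝ≥0 | s ≤ u ∧ u ≤ t}).Nonempty :=
      ⟨_, t, ⟨hst, le_rfl⟩, rfl⟩
    obtain ⟨u, ⟨hu1, hu2⟩, hu⟩ := hne.csSup_mem hfin
    refine ⟨u, hu1, hu2, h.trans_eq ?_⟩
    rw [runningSup, ← hu]
  · rintro ⟨u, hu1, hu2, hu⟩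
    exact hu.trans (sub_le_sub_right (le_csSup hfin.bddAbove ⟨u, ⟨hu1, hu2⟩, rfl⟩) _)

lemma drawdownTime_succ (Y : ℝ≥0 → Ω → S) (a : ℝ) (n : ℕ) (ω : Ω) :
    drawdownTime Y a (n + 1) ω =
      ⨅ (t : ℝ≥0) (_ : drawdownTime Y a n ω < t ∧ ∃ u : ℝ≥0, drawdownTime Y a n ω ≤ u ∧ u ≤ t ∧
        a ≤ (Y u ω : ℝ) - Y t ω), (t : ℝ≥0∞) := by
  rw [drawdownTime]
  refine iInf_congr fun t => iInf_congr_Prop ?_ fun _ => rfl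
  exact and_congr_right fun h => le_runningSup_sub_iff h.le a

/-- The coordinate process on the space of paths. -/
def coordProcess (S : Finset ℝ) : ℝ≥0 → (ℝ≥0 → S) → S := fun t p => p t

lemma drawdownTime_eq_coordProcess (Y : ℝ≥0 → Ω → S) (a : ℝ) (n : ℕ) (ω : Ω) :
    drawdownTime Y a n ω = drawdownTime (coordProcess S) a n fun t => Y t ω := by
  induction n with
  | zero => rfl
  | succ n ih => rw [drawdownTime, drawdownTime, ih]; rfl

/-- The drawdown time computed from the values of the path on a countable set of times. -/
def gridDrawdownTime (a : ℝ) : ℕ → (ℝ≥0 → S) → ℝ≥0∞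
  | 0, _ => 0
  | n + 1, p => ⨅ i : ℕ × ℕ, ⨅ j : ℕ × ℕ,
      if gridDrawdownTime a n p ≤ gridPoint i ∧ gridPoint i < gridPoint j ∧
        a ≤ (p (gridPoint i) : ℝ) - p (gridPoint j) then (gridPoint j : ℝ≥0∞) else ⊤

lemma measurable_gridDrawdownTime (a : ℝ) (n : ℕ) :
    Measurable (gridDrawdownTime (S := S) a n) := by
  induction n with
  | zero => exact measurable_const
  | succ n ih =>
    refine Measurable.iInf fun i => Measurable.iInf fun j => Measurable.ite ?_ measurable_const
      measurable_const
    refine (ih measurableSet_Iic).inter (MeasurableSet.inter (MeasurableSet.const _) ?_)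
    have h : ∀ t : ℝ≥0, Measurable fun p : ℝ≥0 → S => (p t : ℝ) := fun t =>
      measurable_subtype_coe.comp (measurable_pi_apply (X := fun _ : ℝ≥0 => S) t)
    exact measurableSet_le measurable_const ((h _).sub (h _))

/-- Since `a > 0`, the high point `u` strictly precedes the low point `t`. Their states recur at a
grid point in `(u, t)` and at one just after `t`. This supplies a functional that is measurable on
all of path space and correct on right-continuous paths. -/
lemma gridDrawdownTime_eq {a : ℝ} (ha : 0 < a) {p : ℝ≥0 → S}
    (h : ∀ t, ContinuousWithinAt p (Set.Ici t) t) (n : ℕ) :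
    gridDrawdownTime a n p = drawdownTime (coordProcess S) a n p := by
  induction n with
  | zero => rfl
  | succ n ih =>
    rw [drawdownTime_succ, gridDrawdownTime, ih]
    refine le_antisymm (le_iInf₂ fun t ht => le_of_forall_gt fun s hs => ?_)
      (le_iInf fun i => le_iInf fun j => ?_)
    · obtain ⟨hτt, u, hτu, hut, hu⟩ := ht
      have hut' : u < t := lt_of_le_of_ne hut fun hne => by
        rw [hne, sub_self] at hu
        exact hu.not_gt ha
      obtain ⟨s', hts', hs's⟩ := ENNReal.lt_iff_exists_nnreal_btwn.1 hs
      obtain ⟨i, hui, hit, hi⟩ := exists_gridPoint h hut'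
      obtain ⟨j, htj, hjs, hj⟩ := exists_gridPoint h (ENNReal.coe_lt_coe.1 hts')
      refine (iInf₂_le i j).trans_lt ?_
      rw [if_pos ⟨hτu.trans (by exact_mod_cast hui.le), hit.trans htj, by rw [hi, hj]; exact hu⟩]
      exact (ENNReal.coe_lt_coe.2 hjs).trans hs's
    · split_ifs with hij
      · exact iInf₂_le (gridPoint j) ⟨hij.1.trans_lt (by exact_mod_cast hij.2.1), gridPoint i,
          hij.1, hij.2.1.le, hij.2.2⟩
      · exact le_top

lemma drawdownTime_eq_gridDrawdownTime {Y : ℝ≥0 → Ω → S} {a : ℝ} (ha : 0 < a) {ω : Ω}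
    (h : ∀ t, ContinuousWithinAt (fun s => Y s ω) (Set.Ici t) t) (n : ℕ) :
    drawdownTime Y a n ω = gridDrawdownTime a n fun t => Y t ω := by
  rw [drawdownTime_eq_coordProcess, gridDrawdownTime_eq ha h]

lemma drawdownTime_succ_eq_top {Y : ℝ≥0 → Ω → S} {a : ℝ} {n : ℕ} {ω : Ω}
    (h : drawdownTime Y a n ω = ⊤) : drawdownTime Y a (n + 1) ω = ⊤ := by
  rw [drawdownTime_succ, h]
  simp

/-- The recursion sees only the path from the current drawdown time onwards, so a relation between
two drawdown times passes to their successors. -/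
lemma drawdownTime_shift {p : ℝ≥0 → S} {a : ℝ} {n k : ℕ} {T : ℝ≥0}
    (h : drawdownTime (coordProcess S) a n p =
      T + drawdownTime (coordProcess S) a k fun t => p (T + t)) :
    drawdownTime (coordProcess S) a (n + 1) p =
      T + drawdownTime (coordProcess S) a (k + 1) fun t => p (T + t) := by
  rw [drawdownTime_succ, drawdownTime_succ, h]
  refine le_antisymm (tsub_le_iff_left.1 (le_iInf₂ fun t ht => tsub_le_iff_left.2 ?_))
    (le_iInf₂ fun t ht => ?_)
  · obtain ⟨h1, u, h2, h3, h4⟩ := ht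
    rw [← ENNReal.coe_add]
    refine iInf₂_le (T + t) ⟨?_, T + u, ?_, by gcongr, h4⟩
    · rw [ENNReal.coe_add]
      exact ENNReal.add_lt_add_left (by simp) h1
    · rw [ENNReal.coe_add]
      gcongr
  · obtain ⟨h1, u, h2, h3, h4⟩ := ht
    obtain ⟨u, rfl⟩ : ∃ u', u = T + u' :=
      exists_add_of_le (ENNReal.coe_le_coe.1 (le_self_add.trans h2))
    obtain ⟨t, rfl⟩ : ∃ t', t = T + t' := exists_add_of_le (le_self_add.trans h3)
    rw [ENNReal.coe_add] at h1 h2 ⊢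
    gcongr
    exact iInf₂_le t ⟨(ENNReal.add_lt_add_iff_left (by simp)).1 h1, u,
      (ENNReal.add_le_add_iff_left (by simp)).1 h2, (add_le_add_iff_left T).1 h3, h4⟩

/-! ### Drawdowns before and after the exit from `(x - a, x]` -/

section Decomposition

variable {p : ℝ≥0 → S} {a : ℝ} {x : S}

lemma coe_le_of_lt_firstPassageTime (hp0 : p 0 = x) {u : ℝ≥0}
    (hu : u < firstPassageTime (coordProcess S) (Set.Ioc ((x : ℝ) - a) x) p) :
    (p u : ℝ) ≤ x := by
  rcases eq_or_ne u 0 with rfl | h0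
  · rw [hp0]
  · exact (coe_mem_of_lt_firstPassageTime (pos_of_ne_zero h0) hu).2

lemma not_drawdown_of_lt_firstPassageTime (hp0 : p 0 = x) {u t : ℝ≥0} (ht : 0 < t) (hut : u ≤ t)
    (h : t < firstPassageTime (coordProcess S) (Set.Ioc ((x : ℝ) - a) x) p) :
    ¬ a ≤ (p u : ℝ) - p t := by
  have h1 := coe_le_of_lt_firstPassageTime hp0 ((ENNReal.coe_le_coe.2 hut).trans_lt h)
  have h2 : (x : ℝ) - a < p t := (coe_mem_of_lt_firstPassageTime ht h).1
  linarith

lemma drawdownTime_one_eq_top (hp0 : p 0 = x)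
    (hT : firstPassageTime (coordProcess S) (Set.Ioc ((x : ℝ) - a) x) p = ⊤) :
    drawdownTime (coordProcess S) a 1 p = ⊤ := by
  rw [drawdownTime_succ]
  refine top_le_iff.1 (le_iInf₂ fun t ht => ?_)
  obtain ⟨h1, u, -, hut, hu⟩ := ht
  refine absurd hu (not_drawdown_of_lt_firstPassageTime hp0 ?_ hut (by rw [hT]; simp))
  simpa [drawdownTime] using h1

lemma drawdownTime_one_eq_firstPassageTime (ha : 0 < a) (hp0 : p 0 = x) {T : ℝ≥0}
    (hT : firstPassageTime (coordProcess S) (Set.Ioc ((x : ℝ) - a) x) p = T)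
    (hdown : (p T : ℝ) ≤ x - a) :
    drawdownTime (coordProcess S) a 1 p = T := by
  have hT0 : 0 < T := pos_of_ne_zero fun h => by
    rw [h, hp0] at hdown
    linarith
  rw [drawdownTime_succ]
  refine le_antisymm ?_ (le_iInf₂ fun t ht => ?_)
  -- The high point is time `0`, where the path is at `x`.
  · refine iInf₂_le T ⟨by simpa [drawdownTime] using hT0, 0, by simp [drawdownTime],
      zero_le, ?_⟩
    change a ≤ (p 0 : ℝ) - p T
    rw [hp0]
    linarith
  · obtain ⟨h1, u, -, hut, hu⟩ := ht
    by_contra htT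
    rw [not_le, ← hT] at htT
    exact not_drawdown_of_lt_firstPassageTime hp0 (by simpa [drawdownTime] using h1) hut htT hu

/-- The state at `T` exceeds everything seen before, so a high point before `T` can be replaced by
`T` itself. -/
lemma drawdownTime_one_eq_add (ha : 0 < a) (hp0 : p 0 = x) {T : ℝ≥0}
    (hT : firstPassageTime (coordProcess S) (Set.Ioc ((x : ℝ) - a) x) p = T)
    (hup : (x : ℝ) < p T) :
    drawdownTime (coordProcess S) a 1 p =
      T + drawdownTime (coordProcess S) a 1 fun t => p (T + t) := by
  rw [drawdownTime_succ, drawdownTime_succ]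
  refine le_antisymm (tsub_le_iff_left.1 (le_iInf₂ fun t ht => tsub_le_iff_left.2 ?_))
    (le_iInf₂ fun t ht => ?_)
  · obtain ⟨h1, u, -, h3, h4⟩ := ht
    rw [← ENNReal.coe_add]
    refine iInf₂_le (T + t) ⟨?_, T + u, by simp [drawdownTime], by gcongr, h4⟩
    exact h1.trans_le (by simp)
  · obtain ⟨h1, u, -, h3, h4⟩ := ht
    have h1' : 0 < t := by simpa [drawdownTime] using h1
    change a ≤ (p u : ℝ) - p t at h4
    have hbefore : ∀ u : ℝ≥0, u < T → (p u : ℝ) ≤ x := fun u hu =>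
      coe_le_of_lt_firstPassageTime hp0 (by rw [hT]; exact_mod_cast hu)
    -- No drawdown occurs at `T` either: `p T` exceeds all earlier values, and `u = T` gives
    -- difference `0 < a`.
    have hTt : T < t := by
      rcases lt_trichotomy t T with h | rfl | h
      · exact absurd h4 (not_drawdown_of_lt_firstPassageTime hp0 h1' h3
          (by rw [hT]; exact_mod_cast h))
      · rcases h3.lt_or_eq with h3 | rfl
        · linarith [hbefore u h3]
        · linarith
      · exact h
    obtain ⟨t, rfl⟩ : ∃ t', t = T + t' := exists_add_of_le hTt.le
    rw [ENNReal.coe_add]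
    gcongr
    refine iInf₂_le t ⟨?_, ?_⟩
    · simpa [drawdownTime] using hTt
    · rcases lt_or_ge u T with hu | hu
      · refine ⟨0, by simp [drawdownTime], zero_le, ?_⟩
        change a ≤ (p (T + 0) : ℝ) - p (T + t)
        rw [add_zero]
        linarith [hbefore u hu]
      · obtain ⟨u, rfl⟩ : ∃ u', u = T + u' := exists_add_of_le hu
        exact ⟨u, by simp [drawdownTime], (add_le_add_iff_left T).1 h3, h4⟩

lemma drawdownTime_eq_top (hp0 : p 0 = x)
    (hT : firstPassageTime (coordProcess S) (Set.Ioc ((x : ℝ) - a) x) p = ⊤) (k : ℕ) :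
    drawdownTime (coordProcess S) a (k + 1) p = ⊤ := by
  induction k with
  | zero => exact drawdownTime_one_eq_top hp0 hT
  | succ k ih => exact drawdownTime_succ_eq_top ih

lemma drawdownTime_eq_of_down (ha : 0 < a) (hp0 : p 0 = x) {T : ℝ≥0}
    (hT : firstPassageTime (coordProcess S) (Set.Ioc ((x : ℝ) - a) x) p = T)
    (hdown : (p T : ℝ) ≤ x - a) (k : ℕ) :
    drawdownTime (coordProcess S) a (k + 1) p =
      T + drawdownTime (coordProcess S) a k fun t => p (T + t) := by
  induction k with
  | zero => simpa [drawdownTime] using drawdownTime_one_eq_firstPassageTime ha hp0 hT hdown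
  | succ k ih => exact drawdownTime_shift ih

lemma drawdownTime_eq_of_up (ha : 0 < a) (hp0 : p 0 = x) {T : ℝ≥0}
    (hT : firstPassageTime (coordProcess S) (Set.Ioc ((x : ℝ) - a) x) p = T)
    (hup : (x : ℝ) < p T) (k : ℕ) :
    drawdownTime (coordProcess S) a (k + 1) p =
      T + drawdownTime (coordProcess S) a (k + 1) fun t => p (T + t) := by
  induction k with
  | zero => exact drawdownTime_one_eq_add ha hp0 hT hup
  | succ k ih => exact drawdownTime_shift ih

end Decomposition

end

/-! ### The renewal equation for the transforms of the drawdown times -/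

section

variable {Ω : Type*} [MeasurableSpace Ω] {S : Finset ℝ} {G : Matrix S S ℝ}
  {ℙ : S → Measure Ω} {Y : ℝ≥0 → Ω → S}

lemma measurable_discount (q : ℂ) : Measurable (discount q) :=
  Measurable.ite measurableSet_Iio (by fun_prop) measurable_const

lemma norm_discount (q : ℂ) (τ : ℝ≥0∞) :
    ‖discount q τ‖ = if τ < ∞ then Real.exp (-q.re * τ.toReal) else 0 := by
  unfold discount
  split_ifs
  · simp [Complex.norm_exp]
  · simp

lemma norm_discount_le_one {q : ℂ} (hq : 0 < q.re) (τ : ℝ≥0∞) : ‖discount q τ‖ ≤ 1 := by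
  rw [norm_discount]
  split_ifs
  · rw [Real.exp_le_one_iff]
    nlinarith [τ.toReal_nonneg]
  · exact zero_le_one

lemma norm_discount_lt_one {q : ℂ} (hq : 0 < q.re) {τ : ℝ≥0∞} (hτ : 0 < τ) :
    ‖discount q τ‖ < 1 := by
  rw [norm_discount]
  split_ifs with h
  · rw [Real.exp_lt_one_iff]
    nlinarith [ENNReal.toReal_pos hτ.ne' h.ne]
  · exact zero_lt_one

lemma discount_coe (q : ℂ) (t : ℝ≥0) : discount q t = Complex.exp (-q * (t : ℝ)) := by
  simp [discount]

lemma discount_coe_add (q : ℂ) (t : ℝ≥0) (τ : ℝ≥0∞) :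
    discount q (t + τ) = discount q t * discount q τ := by
  rcases eq_or_ne τ ⊤ with rfl | h
  · simp [discount]
  · lift τ to ℝ≥0 using h
    rw [← ENNReal.coe_add, discount_coe, discount_coe, discount_coe, ← Complex.exp_add]
    congr 1
    push_cast
    ring

lemma IsCTMC.measurable_drawdownTime (hY : IsCTMC G ℙ Y) {a : ℝ} (ha : 0 < a) (n : ℕ) :
    Measurable (drawdownTime Y a n) := by
  have : drawdownTime Y a n = fun ω => gridDrawdownTime a n fun t => Y t ω :=
    funext fun ω => drawdownTime_eq_gridDrawdownTime ha (hY.rightContinuous ω) n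
  rw [this]
  exact (measurable_gridDrawdownTime a n).comp hY.measurable_path

lemma IsCTMC.integrable_discount (hY : IsCTMC G ℙ Y) {q : ℂ} (hq : 0 < q.re) {τ : Ω → ℝ≥0∞}
    (hτ : Measurable τ) (x : S) : Integrable (fun ω => discount q (τ ω)) (ℙ x) := by
  have := hY.isProbabilityMeasure x
  exact Integrable.of_bound ((measurable_discount q).comp hτ).aestronglyMeasurable 1
    (Filter.Eventually.of_forall fun ω => norm_discount_le_one hq _)

/-- The event that the first passage time out of `A` is finite and the exit state is `y`. -/
def exitEvent (Y : ℝ≥0 → Ω → S) (A : Set ℝ) (y : S) : Set Ω :=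
  {ω | firstPassageTime Y A ω < ∞} ∩ {ω | Y (firstPassageTime Y A ω).toNNReal ω = y}

lemma IsCTMC.measurable_firstPassageTime (hY : IsCTMC G ℙ Y) (A : Set ℝ) :
    Measurable (firstPassageTime Y A) :=
  (isOptionalTime_firstPassageTime hY.rightContinuous A).measurable hY

lemma IsCTMC.measurableSet_exitEvent (hY : IsCTMC G ℙ Y) (A : Set ℝ) (y : S) :
    MeasurableSet (exitEvent Y A y) := by
  have hT := hY.measurable_firstPassageTime A
  refine (hT measurableSet_Iio).inter ?_
  have := (measurable_pi_apply (X := fun _ : ℝ≥0 => S) 0).comp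
    (hY.measurable_shift hT.ennreal_toNNReal)
  simp only [Function.comp_def, add_zero] at this
  exact this (measurableSet_singleton y)

omit [MeasurableSpace Ω] in
lemma firstPassagePayoff_eq_indicator (Y : ℝ≥0 → Ω → S) (A : Set ℝ) (q : ℂ) (y : S) :
    firstPassagePayoff Y A (fun _ => q) (fun z => if z = y then 1 else 0) =
      (exitEvent Y A y).indicator fun ω => discount q (firstPassageTime Y A ω) := by
  classical
  funext ω
  simp only [firstPassagePayoff, exitEvent, Set.indicator_apply, Set.mem_inter_iff,
    Set.mem_ofPred_eq, discount]
  by_cases h1 : firstPassageTime Y A ω < ∞ <;>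
    by_cases h2 : Y (firstPassageTime Y A ω).toNNReal ω = y <;> simp [h1, h2, mul_comm]

lemma IsCTMC.integrable_firstPassagePayoff (hY : IsCTMC G ℙ Y) (A : Set ℝ) {q : ℂ}
    (hq : 0 < q.re) (x y : S) :
    Integrable (firstPassagePayoff Y A (fun _ => q) fun z => if z = y then 1 else 0) (ℙ x) := by
  rw [firstPassagePayoff_eq_indicator]
  exact (hY.integrable_discount hq (hY.measurable_firstPassageTime A) x).indicator
    (hY.measurableSet_exitEvent A y)

/-- The strong Markov property at the first passage time, applied to the path functional
`gridDrawdownTime` for the sake of measurability. -/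
lemma IsCTMC.firstPassageValue_mul_drawdownTransform (hY : IsCTMC G ℙ Y) (A : Set ℝ) {a : ℝ}
    (ha : 0 < a) (q : ℂ) (n : ℕ) (x y : S) :
    firstPassageValue ℙ Y A (fun _ => q) x (fun z => if z = y then 1 else 0) *
        drawdownTransform ℙ Y a q n y =
      ∫ ω, (exitEvent Y A y).indicator (fun ω => discount q (firstPassageTime Y A ω) *
        discount q (drawdownTime (coordProcess S) a n
          fun t => Y ((firstPassageTime Y A ω).toNNReal + t) ω)) ω ∂(ℙ x) := by
  have hE := hY.measurableSet_exitEvent A y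
  have key := hY.setIntegral_mul_shift
    (isOptionalTime_firstPassageTime hY.rightContinuous A) x y
    (f := fun t => discount q t) (g := fun p => discount q (gridDrawdownTime a n p))
    ((measurable_discount q).comp measurable_coe_nnreal_ennreal)
    ((measurable_discount q).comp (measurable_gridDrawdownTime a n))
  rw [firstPassageValue, firstPassagePayoff_eq_indicator, integral_indicator hE,
    integral_indicator hE, drawdownTransform]
  simp only [drawdownTime_eq_gridDrawdownTime ha (hY.rightContinuous _)]
  have h1 : ∀ ω ∈ exitEvent Y A y, discount q (firstPassageTime Y A ω) =
      discount q ((firstPassageTime Y A ω).toNNReal : ℝ≥0∞) := fun ω hω => by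
    rw [ENNReal.coe_toNNReal hω.1.ne]
  have h2 : ∀ ω, drawdownTime (coordProcess S) a n
      (fun t => Y ((firstPassageTime Y A ω).toNNReal + t) ω) =
      gridDrawdownTime a n fun t => Y ((firstPassageTime Y A ω).toNNReal + t) ω := by
    intro ω
    refine (gridDrawdownTime_eq ha (fun t => ?_) n).symm
    exact (hY.rightContinuous ω ((firstPassageTime Y A ω).toNNReal + t)).comp
      (f := fun t => (firstPassageTime Y A ω).toNNReal + t)
      (by fun_prop) (fun s hs => by simpa using hs)
  rw [setIntegral_congr_fun hE h1]
  refine key.symm.trans (setIntegral_congr_fun hE fun ω hω => ?_)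
  simp only [h2, h1 ω hω]

omit [MeasurableSpace Ω] in
/-- The decomposition of a drawdown time at the first passage out of `(x - a, x]`. -/
lemma discount_drawdownTime_eq {ω : Ω} {x : S} {a : ℝ} (ha : 0 < a)
    (hrc : ∀ t, ContinuousWithinAt (fun s => Y s ω) (Set.Ici t) t) (h0 : Y 0 ω = x)
    (q : ℂ) (k : ℕ) :
    discount q (drawdownTime Y a (k + 1) ω) =
      (∑ y ∈ Finset.univ.filter (fun y : S => (y : ℝ) ≤ (x : ℝ) - a),
        (exitEvent Y (Set.Ioc ((x : ℝ) - a) x) y).indicator (fun ω =>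
          discount q (firstPassageTime Y (Set.Ioc ((x : ℝ) - a) x) ω) *
          discount q (drawdownTime (coordProcess S) a k fun t =>
            Y ((firstPassageTime Y (Set.Ioc ((x : ℝ) - a) x) ω).toNNReal + t) ω)) ω) +
      ∑ y ∈ Finset.univ.filter (fun y : S => (x : ℝ) < (y : ℝ)),
        (exitEvent Y (Set.Ioc ((x : ℝ) - a) x) y).indicator (fun ω =>
          discount q (firstPassageTime Y (Set.Ioc ((x : ℝ) - a) x) ω) *
          discount q (drawdownTime (coordProcess S) a (k + 1) fun t =>
            Y ((firstPassageTime Y (Set.Ioc ((x : ℝ) - a) x) ω).toNNReal + t) ω)) ω := by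
  classical
  set A := Set.Ioc ((x : ℝ) - a) x with hA
  have hcoord : firstPassageTime (coordProcess S) A (fun t => Y t ω) = firstPassageTime Y A ω :=
    rfl
  rw [drawdownTime_eq_coordProcess]
  simp only [exitEvent, Set.indicator_apply, Set.mem_inter_iff, Set.mem_ofPred_eq]
  rcases eq_or_ne (firstPassageTime Y A ω) ⊤ with hT | hT
  · rw [drawdownTime_eq_top h0 (hcoord.trans hT)]
    simp [hT, discount]
  · obtain ⟨T, hT⟩ := WithTop.ne_top_iff_exists.1 hT
    change (T : ℝ≥0∞) = _ at hT
    have hnot := coe_firstPassageTime_notMem hrc hT.symm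
    rw [← hT]
    simp only [ENNReal.coe_lt_top, true_and, ENNReal.toNNReal_coe, Finset.sum_ite_eq,
      Finset.mem_filter, Finset.mem_univ]
    -- The exit state lies outside `(x - a, x]`, so exactly one of the two sums contributes, through
    -- a single term.
    rcases le_or_gt (Y T ω : ℝ) (x - a) with hd | hd
    · rw [if_pos hd, if_neg (by linarith),
        drawdownTime_eq_of_down ha h0 (hcoord.trans hT.symm) hd, discount_coe_add, add_zero]
    · have hup : (x : ℝ) < Y T ω := by
        by_contra h
        exact hnot ⟨hd, not_lt.1 h⟩
      rw [if_neg hd.not_ge, if_pos hup,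
        drawdownTime_eq_of_up ha h0 (hcoord.trans hT.symm) hup, discount_coe_add, zero_add]

lemma IsCTMC.drawdownTransform_succ (hY : IsCTMC G ℙ Y) {a : ℝ} (ha : 0 < a) {q : ℂ}
    (hq : 0 < q.re) (k : ℕ) (x : S) :
    drawdownTransform ℙ Y a q (k + 1) x =
      (∑ y ∈ Finset.univ.filter (fun y : S => (y : ℝ) ≤ (x : ℝ) - a),
        firstPassageValue ℙ Y (Set.Ioc ((x : ℝ) - a) x) (fun _ => q) x
          (fun z => if z = y then 1 else 0) * drawdownTransform ℙ Y a q k y) +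
      ∑ y ∈ Finset.univ.filter (fun y : S => (x : ℝ) < (y : ℝ)),
        firstPassageValue ℙ Y (Set.Ioc ((x : ℝ) - a) x) (fun _ => q) x
          (fun z => if z = y then 1 else 0) * drawdownTransform ℙ Y a q (k + 1) y := by
  set A := Set.Ioc ((x : ℝ) - a) x with hA
  have hT := hY.measurable_firstPassageTime A
  have hint : ∀ n y, Integrable ((exitEvent Y A y).indicator fun ω =>
      discount q (firstPassageTime Y A ω) * discount q (drawdownTime (coordProcess S) a n
          fun t => Y ((firstPassageTime Y A ω).toNNReal + t) ω)) (ℙ x) := by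
    intro n y
    have := hY.isProbabilityMeasure x
    refine Integrable.indicator ?_ (hY.measurableSet_exitEvent A y)
    refine Integrable.of_bound (C := 1) (Measurable.aestronglyMeasurable ?_)
      (Filter.Eventually.of_forall fun ω => ?_)
    · refine ((measurable_discount q).comp hT).mul ((measurable_discount q).comp ?_)
      have h2 : (fun ω => drawdownTime (coordProcess S) a n
          (fun t => Y ((firstPassageTime Y A ω).toNNReal + t) ω)) = fun ω =>
          gridDrawdownTime a n fun t => Y ((firstPassageTime Y A ω).toNNReal + t) ω := by
        funext ω
        refine (gridDrawdownTime_eq ha (fun t => ?_) n).symm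
        exact (hY.rightContinuous ω ((firstPassageTime Y A ω).toNNReal + t)).comp
          (f := fun t => (firstPassageTime Y A ω).toNNReal + t)
          (by fun_prop) (fun s hs => by simpa using hs)
      rw [h2]
      exact (measurable_gridDrawdownTime a n).comp (hY.measurable_shift hT.ennreal_toNNReal)
    · rw [norm_mul]
      exact mul_le_one₀ (norm_discount_le_one hq _) (norm_nonneg _) (norm_discount_le_one hq _)
  simp only [hY.firstPassageValue_mul_drawdownTransform A ha]
  rw [← integral_finsetSum _ fun y _ => hint k y, ← integral_finsetSum _ fun y _ => hint (k + 1) y,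
    ← integral_add (integrable_finsetSum _ fun y _ => hint k y)
      (integrable_finsetSum _ fun y _ => hint (k + 1) y), drawdownTransform]
  refine integral_congr_ae ?_
  filter_upwards [hY.start x] with ω h0
  exact discount_drawdownTime_eq ha (hY.rightContinuous ω) h0 q k

/-! ### Geometric decay of the transforms and the linear system -/

omit [MeasurableSpace Ω] in
lemma firstPassageTime_pos {ω : Ω} {A : Set ℝ}
    (hrc : ∀ t, ContinuousWithinAt (fun s => Y s ω) (Set.Ici t) t) (h0 : (Y 0 ω : ℝ) ∈ A) :
    0 < firstPassageTime Y A ω :=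
  pos_of_ne_zero fun h => coe_firstPassageTime_notMem hrc (T := 0) (by simpa using h) h0

/-- The exit events for distinct `y` are disjoint, so the sum is at most `𝔼_x[e^{-Re(q) T}]`; this
is below `1` because a right-continuous path started in `A` needs positive time to leave. -/
lemma IsCTMC.sum_norm_firstPassageValue_lt_one (hY : IsCTMC G ℙ Y) {A : Set ℝ} {q : ℂ}
    (hq : 0 < q.re) {x : S} (hx : (x : ℝ) ∈ A) :
    ∑ y : S, ‖firstPassageValue ℙ Y A (fun _ => q) x (fun z => if z = y then 1 else 0)‖ < 1 := by
  classical
  have := hY.isProbabilityMeasure x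
  have hint := hY.integrable_discount hq (hY.measurable_firstPassageTime A) x
  have hle : ∑ y : S,
      ‖firstPassageValue ℙ Y A (fun _ => q) x (fun z => if z = y then 1 else 0)‖ ≤
      ∫ ω, ‖discount q (firstPassageTime Y A ω)‖ ∂(ℙ x) := by
    calc _ ≤ ∑ y : S, ∫ ω, ‖firstPassagePayoff Y A (fun _ => q)
          (fun z => if z = y then 1 else 0) ω‖ ∂(ℙ x) :=
        Finset.sum_le_sum fun y _ => norm_integral_le_integral_norm _
      _ = ∫ ω, ∑ y : S, ‖firstPassagePayoff Y A (fun _ => q)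
          (fun z => if z = y then 1 else 0) ω‖ ∂(ℙ x) :=
        (integral_finsetSum _ fun y _ => (hY.integrable_firstPassagePayoff A hq x y).norm).symm
      _ ≤ _ := by
        refine integral_mono (integrable_finsetSum _ fun y _ =>
          (hY.integrable_firstPassagePayoff A hq x y).norm) hint.norm fun ω => ?_
        simp only [firstPassagePayoff_eq_indicator, exitEvent, Set.indicator_apply,
          Set.mem_inter_iff, Set.mem_ofPred_eq]
        by_cases h : firstPassageTime Y A ω < ∞
        · simp [h, apply_ite norm, Finset.sum_ite_eq]
        · simp [h]
  refine hle.trans_lt (sub_pos.1 ?_)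
  have h1 : ∫ ω, (1 - ‖discount q (firstPassageTime Y A ω)‖) ∂(ℙ x) =
      1 - ∫ ω, ‖discount q (firstPassageTime Y A ω)‖ ∂(ℙ x) := by
    rw [integral_sub (integrable_const _) hint.norm]
    simp
  rw [← h1, integral_pos_iff_support_of_nonneg
    (fun ω => sub_nonneg.2 (norm_discount_le_one hq _)) ((integrable_const _).sub hint.norm)]
  have hfull : ∀ᵐ ω ∂(ℙ x),
      ω ∈ Function.support fun ω => 1 - ‖discount q (firstPassageTime Y A ω)‖ := by
    filter_upwards [hY.start x] with ω h0
    refine (sub_pos.2 (norm_discount_lt_one hq (firstPassageTime_pos (hY.rightContinuous ω) ?_))).ne'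
    rwa [h0]
  have hfull' : (Function.support fun ω => 1 - ‖discount q (firstPassageTime Y A ω)‖) =ᵐ[ℙ x]
      Set.univ := Filter.eventuallyEq_univ.2 hfull
  rw [measure_congr hfull']
  simp

/-- The recursion is implicit in `h (k + 1)`, but with `ρ < 1` the largest row sum it yields `‖h (k
+ 1)‖ ≤ ρ * max ‖h k‖ ‖h (k + 1)‖`, and hence `‖h (k + 1)‖ ≤ ρ * ‖h k‖`. -/
lemma summable_of_renewal {ι : Type*} [Fintype ι] (P : ι → ι → ℂ) (D U : ι → Finset ι)
    (hDU : ∀ x, Disjoint (D x) (U x)) (hP : ∀ x, ∑ y, ‖P x y‖ < 1) (h : ℕ → ι → ℂ)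
    (hrec : ∀ k x, h (k + 1) x = ∑ y ∈ D x, P x y * h k y + ∑ y ∈ U x, P x y * h (k + 1) y) :
    Summable h := by
  classical
  rcases isEmpty_or_nonempty ι with hι | hι
  · exact summable_zero.congr fun _ => Subsingleton.elim _ _
  obtain ⟨x₀, hx₀⟩ := Finite.exists_max fun x => ∑ y, ‖P x y‖
  set ρ := ∑ y, ‖P x₀ y‖ with hρ
  have hρ0 : 0 ≤ ρ := Finset.sum_nonneg fun y _ => norm_nonneg _
  have hmax : ∀ k, ‖h (k + 1)‖ ≤ ρ * max ‖h k‖ ‖h (k + 1)‖ := by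
    intro k
    set M := max ‖h k‖ ‖h (k + 1)‖ with hM
    have hM0 : 0 ≤ M := (norm_nonneg _).trans (le_max_left _ _)
    refine (pi_norm_le_iff_of_nonneg (by positivity)).2 fun x => ?_
    rw [hrec]
    refine (norm_add_le _ _).trans ((add_le_add (norm_sum_le _ _) (norm_sum_le _ _)).trans ?_)
    calc _ ≤ (∑ y ∈ D x, ‖P x y‖ * M) + ∑ y ∈ U x, ‖P x y‖ * M := by
          refine add_le_add (Finset.sum_le_sum fun y _ => ?_) (Finset.sum_le_sum fun y _ => ?_)
          · rw [norm_mul]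
            exact mul_le_mul_of_nonneg_left ((norm_le_pi_norm (h k) y).trans (le_max_left _ _))
              (norm_nonneg _)
          · rw [norm_mul]
            exact mul_le_mul_of_nonneg_left
              ((norm_le_pi_norm (h (k + 1)) y).trans (le_max_right _ _)) (norm_nonneg _)
      _ ≤ ∑ y, ‖P x y‖ * M := by
          rw [← Finset.sum_union (hDU x)]
          exact Finset.sum_le_sum_of_subset_of_nonneg (Finset.subset_univ _)
            fun y _ _ => mul_nonneg (norm_nonneg _) hM0
      _ ≤ ρ * M := by
          rw [← Finset.sum_mul]
          exact mul_le_mul_of_nonneg_right (hx₀ x) hM0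
  refine summable_of_ratio_norm_eventually_le (hP x₀) (Filter.Eventually.of_forall fun k => ?_)
  rcases le_total ‖h (k + 1)‖ ‖h k‖ with hle | hle
  · simpa [max_eq_left hle] using hmax k
  -- If the maximum is `‖h (k + 1)‖`, then `ρ < 1` forces it to vanish.
  · have h1 := hmax k
    rw [max_eq_right hle] at h1
    have h2 : ‖h (k + 1)‖ = 0 := by nlinarith [norm_nonneg (h (k + 1)), hP x₀]
    rw [h2]
    positivity

lemma IsCTMC.summable_drawdownTransform (hY : IsCTMC G ℙ Y) {a : ℝ} (ha : 0 < a) {q : ℂ}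
    (hq : 0 < q.re) (x : S) : Summable fun k => drawdownTransform ℙ Y a q k x := by
  have h := summable_of_renewal _ _ _
    (fun x : S => Finset.disjoint_filter.2 fun y _ (h1 : (y : ℝ) ≤ (x : ℝ) - a)
      (h2 : (x : ℝ) < (y : ℝ)) => by linarith)
    (fun x : S => hY.sum_norm_firstPassageValue_lt_one hq (A := Set.Ioc ((x : ℝ) - a) x)
      ⟨by linarith, le_rfl⟩)
    (fun k x => drawdownTransform ℙ Y a q k x) (hY.drawdownTransform_succ ha hq)
  exact Pi.summable.1 h x

lemma IsCTMC.drawdownTransform_zero (hY : IsCTMC G ℙ Y) (a : ℝ) (q : ℂ) (x : S) :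
    drawdownTransform ℙ Y a q 0 x = 1 := by
  have := hY.isProbabilityMeasure x
  simp [drawdownTransform, drawdownTime, discount]

/-- Sum the renewal equation over `k`: the lowered index in the downward sum brings in `h 0 = 1`,
the source of the summand `1`. -/
lemma IsCTMC.drawdownSeries_eq (hY : IsCTMC G ℙ Y) {a : ℝ} (ha : 0 < a) {q : ℂ}
    (hq : 0 < q.re) (x : S) :
    drawdownSeries ℙ Y a q x =
      (∑ y ∈ Finset.univ.filter (fun y : S => (y : ℝ) ≤ (x : ℝ) - a),
        firstPassageValue ℙ Y (Set.Ioc ((x : ℝ) - a) x) (fun _ => q) x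
          (fun z => if z = y then 1 else 0) * (1 + drawdownSeries ℙ Y a q y)) +
      ∑ y ∈ Finset.univ.filter (fun y : S => (x : ℝ) < (y : ℝ)),
        firstPassageValue ℙ Y (Set.Ioc ((x : ℝ) - a) x) (fun _ => q) x
          (fun z => if z = y then 1 else 0) * drawdownSeries ℙ Y a q y := by
  have hs := hY.summable_drawdownTransform ha hq
  have hs' := fun y => (summable_nat_add_iff 1).2 (hs y)
  have h1 : ∀ y, HasSum (fun k => drawdownTransform ℙ Y a q k y)
      (1 + drawdownSeries ℙ Y a q y) := fun y => by
    have := (hs y).hasSum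
    rwa [(hs y).tsum_eq_zero_add, hY.drawdownTransform_zero] at this
  have h2 : ∀ y, HasSum (fun k => drawdownTransform ℙ Y a q (k + 1) y)
      (drawdownSeries ℙ Y a q y) := fun y => (hs' y).hasSum
  refine (h2 x).unique ?_
  simp only [hY.drawdownTransform_succ ha hq _ x]
  exact (hasSum_sum fun y _ => (h1 y).mul_left _).add (hasSum_sum fun y _ => (h2 y).mul_left _)

end

/-! ### The Laplace transform in the maturity -/

section

/-- The payment discounted at the rate `r` which is made at time `τ` if `τ` precedes `T`. -/
def paymentBefore (r T : ℝ) (τ : ℝ≥0∞) : ℝ :=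
  if τ < ENNReal.ofReal T then Real.exp (-r * τ.toReal) else 0

lemma paymentBefore_nonneg (r T : ℝ) (τ : ℝ≥0∞) : 0 ≤ paymentBefore r T τ := by
  unfold paymentBefore
  split_ifs <;> positivity

lemma exp_mul_paymentBefore_coe (q : ℂ) (r : ℝ) (t : ℝ≥0) :
    (fun T : ℝ => Complex.exp (-q * T) * (paymentBefore r T t : ℂ)) =
      (Set.Ioi (t : ℝ)).indicator fun T => Complex.exp (-q * T) * Complex.exp (-r * (t : ℝ)) := by
  funext T
  simp only [paymentBefore, ENNReal.lt_ofReal_iff_toReal_lt ENNReal.coe_ne_top,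
    ENNReal.coe_toReal, Set.indicator_apply, Set.mem_Ioi]
  split_ifs <;> simp

lemma integrableOn_exp_mul_paymentBefore {q : ℂ} (hq : 0 < q.re) (r : ℝ) (τ : ℝ≥0∞) :
    IntegrableOn (fun T : ℝ => Complex.exp (-q * T) * (paymentBefore r T τ : ℂ)) (Set.Ioi 0) := by
  rcases eq_or_ne τ ⊤ with rfl | h
  · simp [paymentBefore]
  · lift τ to ℝ≥0 using h
    rw [exp_mul_paymentBefore_coe]
    refine Integrable.integrableOn ?_
    rw [integrable_indicator_iff measurableSet_Ioi]
    exact (integrableOn_exp_mul_complex_Ioi (by simpa using hq) _).mul_const _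

lemma integral_exp_mul_paymentBefore {q : ℂ} (hq : 0 < q.re) (r : ℝ) (τ : ℝ≥0∞) :
    ∫ T in Set.Ioi (0 : ℝ), Complex.exp (-q * T) * (paymentBefore r T τ : ℂ) =
      discount (q + r) τ / q := by
  rcases eq_or_ne τ ⊤ with rfl | h
  · simp [paymentBefore, discount]
  · lift τ to ℝ≥0 using h
    have hsub : Set.Ioi (0 : ℝ) ∩ Set.Ioi (τ : ℝ) = Set.Ioi (τ : ℝ) :=
      Set.inter_eq_right.2 (Set.Ioi_subset_Ioi τ.2)
    rw [exp_mul_paymentBefore_coe, setIntegral_indicator measurableSet_Ioi, hsub,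
      integral_mul_const, integral_exp_mul_complex_Ioi (by simpa using hq), discount_coe,
      neg_div_neg_eq, div_mul_eq_mul_div, ← Complex.exp_add]
    congr 2
    ring

/-- The norm of the integrand is the same integrand with `q` replaced by its real part. -/
lemma integral_norm_exp_mul_paymentBefore {q : ℂ} (hq : 0 < q.re) (r : ℝ) (τ : ℝ≥0∞) :
    ∫ T in Set.Ioi (0 : ℝ), ‖Complex.exp (-q * T) * (paymentBefore r T τ : ℂ)‖ =
      ‖discount (q + r) τ‖ / q.re := by
  have h1 : (((∫ T in Set.Ioi (0 : ℝ), ‖Complex.exp (-q * T) * (paymentBefore r T τ : ℂ)‖) : ℝ) : ℂ)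
      = discount ((q.re : ℂ) + r) τ / (q.re : ℂ) := by
    rw [← integral_exp_mul_paymentBefore (by simpa using hq), ← integral_complex_ofReal]
    refine integral_congr_ae (Filter.Eventually.of_forall fun T => ?_)
    simp [Complex.norm_exp, abs_of_nonneg (paymentBefore_nonneg r T τ)]
  have h2 := congrArg norm h1
  rw [Complex.norm_real, norm_div, Complex.norm_real, Real.norm_of_nonneg hq.le,
    Real.norm_of_nonneg (integral_nonneg fun T => norm_nonneg _)] at h2
  rw [h2, norm_discount, norm_discount]
  simp

variable {Ω : Type*} [MeasurableSpace Ω]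

lemma measurable_paymentBefore (r : ℝ) : Measurable fun z : ℝ × ℝ≥0∞ => paymentBefore r z.1 z.2 :=
  Measurable.ite (measurableSet_lt measurable_snd (by fun_prop)) (by fun_prop) measurable_const

/-- On `τ < T` one has `1 ≤ e^{c(T - τ)}`. The choice `c = |r|` handles negative rates; `c = Re(q)`
compares the price with the transforms at `q + r`. -/
lemma paymentBefore_le (r T : ℝ) {c : ℝ} (hc : 0 ≤ c) (τ : ℝ≥0∞) :
    paymentBefore r T τ ≤ Real.exp (c * T) * ‖discount ((c : ℂ) + r) τ‖ := by
  unfold paymentBefore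
  split_ifs with h
  · have hτ : τ < ∞ := h.trans ENNReal.ofReal_lt_top
    rw [norm_discount, if_pos hτ, ← Real.exp_add, Real.exp_le_exp]
    have := (ENNReal.lt_ofReal_iff_toReal_lt hτ.ne).1 h
    simp only [Complex.add_re, Complex.ofReal_re]
    nlinarith
  · positivity

lemma integrable_paymentBefore {μ : Measure Ω} [IsFiniteMeasure μ] {τ : Ω → ℝ≥0∞}
    (hτ : Measurable τ) (r T : ℝ) : Integrable (fun ω => paymentBefore r T (τ ω)) μ := by
  refine Integrable.of_bound (C := Real.exp (|r| * T))
    ((measurable_paymentBefore r).comp (measurable_const.prodMk hτ)).aestronglyMeasurable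
    (Filter.Eventually.of_forall fun ω => ?_)
  rw [Real.norm_of_nonneg (paymentBefore_nonneg _ _ _)]
  refine (paymentBefore_le r T (abs_nonneg r) (τ ω)).trans
    (mul_le_of_le_one_right (Real.exp_nonneg _) ?_)
  rw [norm_discount]
  split_ifs
  · rw [Real.exp_le_one_iff]
    have h1 := neg_abs_le r
    have h2 := (τ ω).toReal_nonneg
    simp only [Complex.add_re, Complex.ofReal_re]
    nlinarith
  · exact zero_le_one

lemma integrable_prod_exp_mul_paymentBefore {μ : Measure Ω} [IsFiniteMeasure μ] {τ : Ω → ℝ≥0∞}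
    (hτ : Measurable τ) {q : ℂ} (hq : 0 < q.re) {r : ℝ} (hr : 0 < q.re + r) :
    Integrable (fun z : ℝ × Ω => Complex.exp (-q * z.1) * (paymentBefore r z.1 (τ z.2) : ℂ))
      ((volume.restrict (Set.Ioi 0)).prod μ) := by
  have hm : Measurable fun z : ℝ × Ω =>
      Complex.exp (-q * z.1) * (paymentBefore r z.1 (τ z.2) : ℂ) := by
    refine Measurable.mul (by fun_prop) (Complex.measurable_ofReal.comp ?_)
    exact (measurable_paymentBefore r).comp (measurable_fst.prodMk (hτ.comp measurable_snd))
  rw [integrable_prod_iff' hm.aestronglyMeasurable]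
  refine ⟨Filter.Eventually.of_forall fun ω =>
    integrableOn_exp_mul_paymentBefore hq r (τ ω), ?_⟩
  simp only [integral_norm_exp_mul_paymentBefore hq]
  refine Integrable.div_const ?_ _
  refine Integrable.of_bound (C := 1)
    ((measurable_discount _).comp hτ).norm.aestronglyMeasurable
    (Filter.Eventually.of_forall fun ω => ?_)
  rw [norm_norm]
  exact norm_discount_le_one (by simpa using hr) _

/-- The Laplace transform in the maturity of the price of a family of payments. -/
lemma laplace_tsum_paymentBefore {μ : Measure Ω} [IsFiniteMeasure μ] {τ : ℕ → Ω → ℝ≥0∞}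
    (hτ : ∀ k, Measurable (τ k)) {q : ℂ} (hq : 0 < q.re) {r : ℝ} (hr : 0 < q.re + r)
    (hsum : Summable fun k => ∫ ω, ‖discount (q + r) (τ k ω)‖ ∂μ) :
    (∀ T : ℝ, Summable fun k => ∫ ω, paymentBefore r T (τ k ω) ∂μ) ∧
      IntegrableOn (fun T : ℝ => Complex.exp (-q * T) *
        ((∑' k, ∫ ω, paymentBefore r T (τ k ω) ∂μ : ℝ) : ℂ)) (Set.Ioi 0) ∧
      ∫ T in Set.Ioi (0 : ℝ), Complex.exp (-q * T) *
        ((∑' k, ∫ ω, paymentBefore r T (τ k ω) ∂μ : ℝ) : ℂ) =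
          (∑' k, ∫ ω, discount (q + r) (τ k ω) ∂μ) / q := by
  set F : ℕ → ℝ → ℂ := fun k T =>
    ∫ ω, Complex.exp (-q * T) * (paymentBefore r T (τ k ω) : ℂ) ∂μ with hF
  have hFeq : ∀ k T, F k T =
      Complex.exp (-q * T) * ((∫ ω, paymentBefore r T (τ k ω) ∂μ : ℝ) : ℂ) := fun k T => by
    rw [hF, ← integral_complex_ofReal, ← integral_const_mul]
  have hprod := fun k => integrable_prod_exp_mul_paymentBefore (μ := μ) (hτ k) hq hr
  have hFint : ∀ k, Integrable (F k) (volume.restrict (Set.Ioi 0)) := fun k =>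
    (hprod k).integral_prod_left
  have hnorm : ∀ k, ∫ T in Set.Ioi (0 : ℝ), ‖F k T‖ ≤
      (∫ ω, ‖discount (q + r) (τ k ω)‖ ∂μ) / q.re := by
    intro k
    calc ∫ T in Set.Ioi (0 : ℝ), ‖F k T‖ ≤ ∫ T in Set.Ioi (0 : ℝ), ∫ ω,
          ‖Complex.exp (-q * T) * (paymentBefore r T (τ k ω) : ℂ)‖ ∂μ :=
        integral_mono (hFint k).norm (hprod k).norm.integral_prod_left
          fun T => norm_integral_le_integral_norm _
      _ = ∫ ω, (∫ T in Set.Ioi (0 : ℝ),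
          ‖Complex.exp (-q * T) * (paymentBefore r T (τ k ω) : ℂ)‖) ∂μ :=
        integral_integral_swap (hprod k).norm
      _ = _ := by simp only [integral_norm_exp_mul_paymentBefore hq, integral_div]
  have hFsum : Summable fun k => ∫ T in Set.Ioi (0 : ℝ), ‖F k T‖ :=
    Summable.of_nonneg_of_le (fun k => integral_nonneg fun T => norm_nonneg _) hnorm
      (hsum.div_const _)
  have hFtsum : (fun T : ℝ => Complex.exp (-q * T) *
      ((∑' k, ∫ ω, paymentBefore r T (τ k ω) ∂μ : ℝ) : ℂ)) = fun T => ∑' k, F k T := by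
    funext T
    simp only [hFeq, tsum_mul_left, Complex.ofReal_tsum]
  have hS : ∀ T : ℝ, Summable fun k => ∫ ω, paymentBefore r T (τ k ω) ∂μ := by
    intro T
    refine Summable.of_nonneg_of_le (fun k => integral_nonneg fun ω => paymentBefore_nonneg _ _ _)
      (fun k => ?_) (hsum.mul_left (Real.exp (q.re * T)))
    rw [← integral_const_mul]
    have hd : Integrable (fun ω => ‖discount (q + r) (τ k ω)‖) μ :=
      Integrable.of_bound (C := 1) ((measurable_discount _).comp (hτ k)).norm.aestronglyMeasurable
        (Filter.Eventually.of_forall fun ω => by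
          rw [norm_norm]
          exact norm_discount_le_one (by simpa using hr) _)
    refine integral_mono (integrable_paymentBefore (hτ k) r T) (hd.const_mul _) fun ω => ?_
    refine (paymentBefore_le r T hq.le (τ k ω)).trans_eq ?_
    simp [norm_discount]
  rw [hFtsum]
  refine ⟨hS, ?_, ?_⟩
  · refine ⟨?_, ?_⟩
    -- The price is measurable in `T` as a pointwise limit of partial sums; its integrability then
    -- follows from Tonelli.
    · refine aestronglyMeasurable_of_tendsto_ae Filter.atTop
        (f := fun n T => ∑ k ∈ Finset.range n, F k T)
        (fun n => (integrable_finsetSum _ fun k _ => hFint k).aestronglyMeasurable)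
        (Filter.Eventually.of_forall fun T => ?_)
      refine Summable.tendsto_sum_tsum_nat ?_
      simp only [hFeq]
      exact (Complex.hasSum_ofReal.2 (hS T).hasSum).summable.mul_left _
    · have h1 : ∀ k, ∫⁻ T in Set.Ioi (0 : ℝ), ‖F k T‖ₑ =
          ENNReal.ofReal (∫ T in Set.Ioi (0 : ℝ), ‖F k T‖) := fun k => by
        rw [ofReal_integral_norm_eq_lintegral_enorm (hFint k)]
      refine lt_of_le_of_lt (lintegral_mono fun T => enorm_tsum_le_tsum_enorm) ?_
      rw [lintegral_tsum fun k => (hFint k).aestronglyMeasurable.enorm]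
      simp only [h1]
      rw [← ENNReal.ofReal_tsum_of_nonneg (fun k => integral_nonneg fun T => norm_nonneg _) hFsum]
      exact ENNReal.ofReal_lt_top
  · rw [← integral_tsum_of_summable_integral_norm hFint hFsum, ← tsum_div_const]
    refine tsum_congr fun k => ?_
    rw [integral_integral_swap (hprod k)]
    simp only [integral_exp_mul_paymentBefore hq, integral_div]

variable {S : Finset ℝ} {G : Matrix S S ℝ} {ℙ : S → Measure Ω} {Y : ℝ≥0 → Ω → S}

/-- Summable transforms at a complex rate do not control expectations of norms; but these
expectations are the transforms at the real rate `Re(q)`. -/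
lemma IsCTMC.summable_integral_norm_discount (hY : IsCTMC G ℙ Y) {a : ℝ} (ha : 0 < a) {q : ℂ}
    (hq : 0 < q.re) (x : S) :
    Summable fun k => ∫ ω, ‖discount q (drawdownTime Y a (k + 1) ω)‖ ∂(ℙ x) := by
  have h := ((summable_nat_add_iff 1).2
    (hY.summable_drawdownTransform ha (q := q.re) (by simpa using hq) x)).norm
  refine h.congr fun k => ?_
  have h1 : drawdownTransform ℙ Y a q.re (k + 1) x =
      ((∫ ω, ‖discount q (drawdownTime Y a (k + 1) ω)‖ ∂(ℙ x) : ℝ) : ℂ) := by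
    rw [← integral_complex_ofReal, drawdownTransform]
    refine integral_congr_ae (Filter.Eventually.of_forall fun ω => ?_)
    simp only [discount]
    split_ifs <;> simp [Complex.norm_exp]
  rw [h1, Complex.norm_real, Real.norm_of_nonneg (integral_nonneg fun ω => norm_nonneg _)]

end

end

theorem mainTheorem7 {Ω : Type*} [MeasurableSpace Ω] (S : Finset ℝ) (G : Matrix S S ℝ)
    (hG : IsRateMatrix G)
    (hleft : ∀ x : S, (∀ y : S, x ≤ y) → IsAbsorbingState G x)
    (hright : ∀ x : S, (∀ y : S, y ≤ x) → IsAbsorbingState G x)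
    (ℙ : S → Measure Ω) (Y : ℝ≥0 → Ω → S) (hY : IsCTMC G ℙ Y)
    (a : ℝ) (ha : 0 < a) (q : ℂ) (hq : 0 < q.re) (x : S) :
    -- the expectations and the series that define the coefficients and `H(q, x)` converge
    (∀ y : S, Integrable (firstPassagePayoff Y (Set.Ioc ((x : ℝ) - a) x) (fun _ => q)
        (fun z => if z = y then 1 else 0)) (ℙ x)) ∧
    (∀ n : ℕ, Integrable (fun ω => discount q (drawdownTime Y a n ω)) (ℙ x)) ∧
    Summable (fun k : ℕ => drawdownTransform ℙ Y a q (k + 1) x) ∧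
    -- the linear system
    drawdownSeries ℙ Y a q x =
      (∑ y ∈ Finset.univ.filter (fun y : S => (y : ℝ) ≤ (x : ℝ) - a),
        firstPassageValue ℙ Y (Set.Ioc ((x : ℝ) - a) x) (fun _ => q) x
          (fun z => if z = y then 1 else 0) * (1 + drawdownSeries ℙ Y a q y)) +
      ∑ y ∈ Finset.univ.filter (fun y : S => (x : ℝ) < (y : ℝ)),
        firstPassageValue ℙ Y (Set.Ioc ((x : ℝ) - a) x) (fun _ => q) x
          (fun z => if z = y then 1 else 0) * drawdownSeries ℙ Y a q y ∧
    -- the Laplace transform in the maturity of the price of the drawdown insurance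
    ∀ r : ℝ, 0 < q.re + r →
      (∀ T : ℝ, 0 < T →
        (∀ n : ℕ, Integrable (insurancePayment Y a r T n) (ℙ x)) ∧
        Summable (fun k : ℕ => ∫ ω, insurancePayment Y a r T (k + 1) ω ∂(ℙ x))) ∧
      IntegrableOn (fun T : ℝ => Complex.exp (-q * (T : ℂ)) * (insurancePrice ℙ Y a r T x : ℂ))
        (Set.Ioi 0) ∧
      ∫ T in Set.Ioi (0 : ℝ), Complex.exp (-q * (T : ℂ)) * (insurancePrice ℙ Y a r T x : ℂ) =
        drawdownSeries ℙ Y a (q + (r : ℂ)) x / q := by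
  have := hY.isProbabilityMeasure x
  have hτ := hY.measurable_drawdownTime ha
  refine ⟨hY.integrable_firstPassagePayoff _ hq x, fun n => hY.integrable_discount hq (hτ n) x,
    (summable_nat_add_iff 1).2 (hY.summable_drawdownTransform ha hq x),
    hY.drawdownSeries_eq ha hq x, fun r hr => ?_⟩
  -- Two rates occur: `Re(q) > 0` for the integral over `T`, and `Re(q) + r > 0` for summability
  -- over the drawdowns.
  obtain ⟨h1, h2, h3⟩ := laplace_tsum_paymentBefore (μ := ℙ x) (fun k => hτ (k + 1)) hq hr
    (hY.summable_integral_norm_discount ha (by simpa using hr) x)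
  exact ⟨fun T _ => ⟨fun n => integrable_paymentBefore (hτ n) r T, h1 T⟩, h2, h3⟩
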